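/- **Proposition (Local right inverses).** Let $\Omega\subset\mathbb R^2$ be an open set (for instance a bounded polygonal Lipschitz domain) with a face-to-face triangulation $\mathcal M$: a finite set of nondegenerate triangles whose interiors are pairwise disjoint subsets of $\Omega$, whose union is $\overline\Omega$, and such that the boundaries of any two different triangles meet in the convex hull of a (possibly empty) set of common vertices. The shape parameter $\sigma_{\mathcal M}$ is the maximum over $K\in\mathcal M$ of the diameter of $K$ divided by the diameter of the largest ball contained in $K$. For $K\in\mathcal M$ let $\mathcal M_K$ be the barycentric refinement of $K$, i.e. the three triangles obtained by connecting each vertex of $K$ with its barycenter. For an integer $\ell\ge 1$ let $V_\ell(K)$ be the space of all $v\in H^1_0(K)$ that coincide on each $T\in\mathcal M_K$ with a polynomial of total degree at most $\ell$, and let $Q_{\ell-1}(K)$ be the space of all $q\in L^2(K)$ with $\int_K q=0$ that coincide on each $T\in\mathcal M_K$ with a polynomial of total degree at most $\ell-1$. Given $q\in L^2(\Omega)$, consider the local discrete Stokes problem: find $u_K\in V_\ell(K)^2$ and $p_K\in Q_{\ell-1}(K)$ such that $$\int_K\nabla u_K:\nabla v_K-\int_K p_K\operatorname{div}v_K=0\quad\forall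 v_K\in V_\ell(K)^2,\qquad \int_K q_K\operatorname{div}u_K=\int_K q_K\,q\quad\forall q_K\in Q_{\ell-1}(K),$$ and set $R_\ell^Kq:=u_K$ in $K$ and $R_\ell^Kq:=0$ in $\Omega\setminus K$. Then, for every integer $\ell\ge1$, there is a nondecreasing function $c:\mathbb R\to[0,\infty)$ such that, for all $\Omega$, $\mathcal M$ and $K\in\mathcal M$ as above: 1. the local problem has exactly one solution $(u_K,p_K)$ for every $q\in L^2(\Omega)$, and $R_\ell^K$ is a well-defined linear operator from $L^2(\Omega)$ to $H^1_0(\Omega)^2$; 2. $\|\nabla R_\ell^Kq\|_{L^2(\Omega)}\le c(\sigma_{\mathcal M})\,\|q\|_{L^2(K)}$ for all $q\in L^2(\Omega)$; 3. for all $q\in L^2(\Omega)$, if $q_{|K}\in Q_{\ell-1}(K)$, then $\operatorname{div}R_\ell^Kq=q$ in $K$. -/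

import Mathlib

open MeasureTheory
open scoped ContDiff

noncomputable section

namespace LocalStokes

/-- The Euclidean plane. -/
abbrev Plane := EuclideanSpace ℝ (Fin 2)

/-- The Lebesgue space `L²(U)`. -/
abbrev L2 (U : Set Plane) := Lp ℝ 2 (volume.restrict U)

/-- The space `L²₀(U)` of square integrable functions with zero integral over `U`. -/
def L2Zero (U : Set Plane) : Set (L2 U) := {q | ∫ x in U, q x = 0}

/-- `φ ∈ C_c^∞(U)`. -/
structure IsTestFunction (U : Set Plane) (φ : Plane → ℝ) : Prop where
  smooth : ContDiff ℝ ∞ φ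
  compact : HasCompactSupport φ
  support : tsupport φ ⊆ U

/-- Classical partial derivative with respect to the `i`-th coordinate. -/
def pderiv (i : Fin 2) (φ : Plane → ℝ) (x : Plane) : ℝ :=
  fderiv ℝ φ x (EuclideanSpace.single i 1)

/-- `g ∈ L²(U)` is the weak partial derivative `∂ᵢ v` of `v ∈ L²(U)`. -/
def IsWeakPartial (U : Set Plane) (i : Fin 2) (v g : L2 U) : Prop :=
  ∀ φ : Plane → ℝ, IsTestFunction U φ →
    ∫ x in U, v x * pderiv i φ x = -∫ x in U, g x * φ x

/-- The Sobolev space `H¹(U)`. -/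
def H1 (U : Set Plane) : Set (L2 U) := {v | ∀ i, ∃ g, IsWeakPartial U i v g}

open Classical in
/-- The weak partial derivative `∂ᵢ v` in `L²(U)` (the value `0` is used if there is none). -/
def weakPartial (U : Set Plane) (i : Fin 2) (v : L2 U) : L2 U :=
  if h : ∃ g, IsWeakPartial U i v g then h.choose else 0

/-- The Sobolev space `H¹₀(U)`: the closure of `C_c^∞(U)` in `H¹(U)`. -/
def H10 (U : Set Plane) : Set (L2 U) :=
  {v | v ∈ H1 U ∧ ∀ ε : ℝ, 0 < ε → ∃ φ : Plane → ℝ, IsTestFunction U φ ∧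
    eLpNorm (fun x => v x - φ x) 2 (volume.restrict U) ≤ ENNReal.ofReal ε ∧
    ∀ i, eLpNorm (fun x => weakPartial U i v x - pderiv i φ x) 2 (volume.restrict U)
      ≤ ENNReal.ofReal ε}

/-- The (weak) divergence of a vector field. -/
def divergence (U : Set Plane) (u : Fin 2 → L2 U) : L2 U := ∑ i, weakPartial U i (u i)

/-- `∫_U ∇u : ∇v`. -/
def gradInner (U : Set Plane) (u v : Fin 2 → L2 U) : ℝ :=
  ∑ i, ∑ j, ∫ x in U, weakPartial U j (u i) x * weakPartial U j (v i) x

/-- `‖∇u‖_{L²(U)}`, with the Euclidean norm of `2 × 2` tensors. -/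
def gradNorm (U : Set Plane) (u : Fin 2 → L2 U) : ℝ :=
  Real.sqrt (∑ i, ∑ j, ‖weakPartial U j (u i)‖ ^ 2)

/-- Restriction `L²(U) → L²(V)` for `V ⊆ U`. -/
def restrictL2 {U V : Set Plane} (h : V ⊆ U) (q : L2 U) : L2 V :=
  ((Lp.memLp q).mono_measure (Measure.restrict_mono h le_rfl)).toLp q

theorem memLp_indicator {U V : Set Plane} (hV : IsOpen V) (v : L2 V) :
    MemLp (V.indicator v) 2 (volume.restrict U) := by
  rw [memLp_indicator_iff_restrict hV.measurableSet]
  refine (Lp.memLp v).mono_measure ?_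
  rw [Measure.restrict_restrict hV.measurableSet]
  exact Measure.restrict_mono Set.inter_subset_left le_rfl

/-- Extension by zero from `V` to `U`. -/
def zeroExtend (U : Set Plane) {V : Set Plane} (hV : IsOpen V) (v : L2 V) : L2 U :=
  (memLp_indicator (U := U) hV v).toLp (V.indicator v)

/-- A nondegenerate triangle, given by its three vertices. -/
abbrev Triangle := Affine.Simplex ℝ Plane 2

/-- The closed triangle as a set of points. -/
def closedTri (K : Triangle) : Set Plane := convexHull ℝ (Set.range K.points)

/-- The open triangle as a set of points. -/
def openTri (K : Triangle) : Set Plane := interior (closedTri K)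

theorem isOpen_openTri (K : Triangle) : IsOpen (openTri K) := isOpen_interior

/-- Face-to-face simplicial mesh of an open set `Ω`: the open triangles are pairwise disjoint
subsets of `Ω`, the closed ones cover the closure of `Ω`, and the boundaries of any two different
triangles meet in the convex hull of a (possibly empty) set of vertices of the first one. -/
structure IsMesh (Ω : Set Plane) (M : Finset Triangle) : Prop where
  subset : ∀ K ∈ M, openTri K ⊆ Ω
  cover : ⋃ K ∈ M, closedTri K = closure Ω
  disjoint : ∀ K ∈ M, ∀ K' ∈ M, K ≠ K' → Disjoint (openTri K) (openTri K')
  faceToFace : ∀ K ∈ M, ∀ K' ∈ M, K ≠ K' → ∃ S ⊆ Set.range K.points,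
    frontier (closedTri K) ∩ frontier (closedTri K') = convexHull ℝ S

/-- The diameter of the largest ball contained in the triangle. -/
def inballDiam (K : Triangle) : ℝ :=
  sSup {d | ∃ x : Plane, ∃ r : ℝ, 0 ≤ r ∧ d = 2 * r ∧ Metric.closedBall x r ⊆ closedTri K}

/-- The shape parameter of a mesh: the maximum of `diam K / inballDiam K` over its elements. -/
def shapeParameter (M : Finset Triangle) : ℝ :=
  ⨆ K : {K // K ∈ M}, Metric.diam (closedTri K.1) / inballDiam K.1

/-- The barycentric refinement of `K`: the three (closed) triangles spanned by the barycenter and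
two of the vertices of `K`. -/
def barycentricRefinement (K : Triangle) : Set (Set Plane) :=
  Set.range fun i : Fin 3 =>
    convexHull ℝ (insert (Finset.univ.centroid ℝ K.points) (K.points '' {i}ᶜ))

/-- The functions in `L²(U)` that coincide on each member of `𝒯` with a polynomial of
total degree at most `n`. -/
def piecewisePoly (U : Set Plane) (𝒯 : Set (Set Plane)) (n : ℕ) : Set (L2 U) :=
  {v | ∀ T ∈ 𝒯, ∃ P : MvPolynomial (Fin 2) ℝ, P.totalDegree ≤ n ∧
    ∀ᵐ x ∂(volume.restrict U), x ∈ T → v x = MvPolynomial.eval (fun i => x i) P}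

/-- Local velocity components: piecewise polynomials of degree at most `n` on the
barycentric refinement of `K` that are in `H¹₀(K)`. -/
def polyBnd (K : Triangle) (n : ℕ) : Set (L2 (openTri K)) :=
  piecewisePoly (openTri K) (barycentricRefinement K) n ∩ H10 (openTri K)

/-- Local pressures: mean-zero piecewise polynomials of degree at most `n` on the
barycentric refinement of `K`. -/
def polyAvg (K : Triangle) (n : ℕ) : Set (L2 (openTri K)) :=
  piecewisePoly (openTri K) (barycentricRefinement K) n ∩ L2Zero (openTri K)

/-- `(u, p)` solves the local discrete Stokes problem on `K` with data `q ∈ L²(K)`. -/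
structure SolvesLocal (K : Triangle) (ℓ : ℕ) (q : L2 (openTri K))
    (u : Fin 2 → L2 (openTri K)) (p : L2 (openTri K)) : Prop where
  velocity_mem : ∀ i, u i ∈ polyBnd K ℓ
  pressure_mem : p ∈ polyAvg K (ℓ - 1)
  momentum : ∀ v : Fin 2 → L2 (openTri K), (∀ i, v i ∈ polyBnd K ℓ) →
    gradInner (openTri K) u v - ∫ x in openTri K, p x * divergence (openTri K) v x = 0
  continuity : ∀ r ∈ polyAvg K (ℓ - 1),
    ∫ x in openTri K, r x * divergence (openTri K) u x = ∫ x in openTri K, r x * q x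

open Classical in
/-- The operator `R_ℓ^K` on `L²(Ω)`: the velocity of a solution of the local problem with data
`q|_K`, extended by zero to `Ω` (the value `0` is used if there is no solution). -/
def localInverse {Ω : Set Plane} (K : Triangle) (hK : openTri K ⊆ Ω) (ℓ : ℕ) (q : L2 Ω) :
    Fin 2 → L2 Ω :=
  if h : ∃ u p, SolvesLocal K ℓ (restrictL2 hK q) u p then
    fun i => zeroExtend Ω (isOpen_openTri K) (h.choose i)
  else 0

end LocalStokes

end

/-!
Everything rests on one fact: on the barycentric refinement of a triangle `K`, the divergence maps
the velocities of degree `n + 1` onto the pressures of degree `n`, and it has a right inverse whose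
norm is bounded by a constant, depending only on `n`, times `diam K / inballDiam K`
(`exists_divₗ_eq_and_norm_le`).

Given this, the local problem is a finite-dimensional saddle point problem (`IsSaddle`). The
gradient is injective on velocities by Poincaré's inequality, and testing the momentum equation
with a velocity whose divergence is the pressure shows that the pressure of a homogeneous solution
vanishes; so the linear system is injective, hence uniquely solvable. The velocity minimizes the
norm of the gradient among all velocities whose divergence is the `L²` projection of the data onto
the pressures, so the right inverse of the divergence bounds it (`IsSaddle.norm_le`). Divergences of
velocities are pressures, so data that are pressures are reproduced exactly. Extension by zero maps
`H¹₀(K)` to `H¹₀(Ω)` and commutes with weak derivatives.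

To see that the divergence is onto, let `K` be the reference triangle with barycentric coordinates
`λ i` and vertices `a i`, and let `μ = min λ i`, which is a multiple of the hat function of the
barycenter. For a polynomial `f` and an edge vector `t = a i - a m`, the field `μ ^ (j + 1) f t` is
a velocity, and its divergence is `(j + 1) μ ^ j f ∂ₜμ + μ ^ (j + 1) ∂ₜf`, where `∂ₜμ` is `1` on the
triangle of the refinement on which `μ = λ i`, is `-1` on the one on which `μ = λ m`, and vanishes
on the third. With `f = λ m g` this says that, modulo divergences, `μ ^ j λ m g` on one triangle of
the refinement can be exchanged for multiples of `μ ^ (j + 1)`. Induction on the power of `μ`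
reduces all pressures of degree `n` to multiples of `μ ^ n` on a single triangle
(`single_mem_of_edgeDeriv_mem`), and the mean value condition excludes those (`exists_divₗ_eq`).
That `μ ^ (j + 1) f` belongs to `H¹₀` is seen by approximating the minimum by smooth functions
(`refBump`). The right inverse on the reference triangle is bounded because the spaces have finite
dimension; the Piola transform `piola` carries it to `K` and preserves the divergence, at the
cost of a factor controlled by the shape of `K`.
-/

noncomputable section

namespace LocalStokes

/-! ### Test functions and the closure of their gradient graph -/

section Sobolev

variable {U : Set Plane} {φ ψ : Plane → ℝ}

theorem IsTestFunction.memLp (h : IsTestFunction U φ) : MemLp φ 2 (volume.restrict U) :=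
  h.smooth.continuous.memLp_of_hasCompactSupport h.compact

theorem continuous_pderiv (h : ContDiff ℝ 1 φ) (i : Fin 2) : Continuous (pderiv i φ) :=
  (h.continuous_fderiv one_ne_zero).clm_apply continuous_const

theorem tsupport_pderiv_subset (i : Fin 2) (φ : Plane → ℝ) : tsupport (pderiv i φ) ⊆ tsupport φ :=
  tsupport_fderiv_apply_subset ℝ _

theorem IsTestFunction.pderiv (h : IsTestFunction U φ) (i : Fin 2) :
    IsTestFunction U (pderiv i φ) where
  smooth := (h.smooth.fderiv_right (m := ∞) (by simp)).clm_apply contDiff_const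
  compact := h.compact.fderiv_apply ℝ _
  support := (tsupport_pderiv_subset i φ).trans h.support

theorem IsTestFunction.add (h : IsTestFunction U φ) (h' : IsTestFunction U ψ) :
    IsTestFunction U (φ + ψ) where
  smooth := h.smooth.add h'.smooth
  compact := h.compact.add h'.compact
  support := (tsupport_add φ ψ).trans (Set.union_subset h.support h'.support)

theorem IsTestFunction.mul_left (h : IsTestFunction U φ) (h' : ContDiff ℝ ∞ ψ) :
    IsTestFunction U (fun x => ψ x * φ x) where
  smooth := h'.mul h.smooth
  compact := h.compact.mul_left
  support := (tsupport_mul_subset_right (f := ψ) (g := φ)).trans h.support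

theorem isTestFunction_zero : IsTestFunction U 0 where
  smooth := contDiff_zero_fun
  compact := HasCompactSupport.zero
  support := by simp [tsupport]

theorem pderiv_add (h : Differentiable ℝ φ) (h' : Differentiable ℝ ψ) (i : Fin 2) (x : Plane) :
    pderiv i (φ + ψ) x = pderiv i φ x + pderiv i ψ x := by
  simp [pderiv, fderiv_add (h x) (h' x)]

theorem pderiv_mul (h : Differentiable ℝ φ) (h' : Differentiable ℝ ψ) (i : Fin 2) (x : Plane) :
    pderiv i (fun x => φ x * ψ x) x = φ x * pderiv i ψ x + ψ x * pderiv i φ x := by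
  simp [pderiv, fderiv_fun_mul (h x) (h' x)]

theorem pderiv_coord (i j : Fin 2) (x : Plane) :
    pderiv i (fun y : Plane => y j) x = if i = j then 1 else 0 := by
  have : (fun y : Plane => y j) = (EuclideanSpace.proj j : Plane →L[ℝ] ℝ) := rfl
  rw [pderiv, this, ContinuousLinearMap.fderiv]
  simp [eq_comm]

/-- Integration by parts on the plane, one factor having compact support. -/
theorem integral_mul_pderiv (h : ContDiff ℝ 1 φ) (h' : ContDiff ℝ 1 ψ)
    (hc : HasCompactSupport ψ) (i : Fin 2) :
    ∫ x, φ x * pderiv i ψ x = -∫ x, pderiv i φ x * ψ x := by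
  have c1 := continuous_pderiv h i
  have c2 := continuous_pderiv h' i
  refine integral_mul_fderiv_eq_neg_fderiv_mul_of_integrable ?_ ?_ ?_
    (fun x _ => h.differentiable one_ne_zero x) (fun x _ => h'.differentiable one_ne_zero x)
  · exact (c1.mul h'.continuous).integrable_of_hasCompactSupport hc.mul_left
  · exact (h.continuous.mul c2).integrable_of_hasCompactSupport (hc.fderiv_apply ℝ _).mul_left
  · exact (h.continuous.mul h'.continuous).integrable_of_hasCompactSupport hc.mul_left

theorem IsTestFunction.setIntegral_mul (h : IsTestFunction U φ) (ψ : Plane → ℝ) :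
    ∫ x in U, ψ x * φ x = ∫ x, ψ x * φ x :=
  setIntegral_eq_integral_of_forall_compl_eq_zero fun x hx => by
    rw [image_eq_zero_of_notMem_tsupport fun hx' => hx (h.support hx'), mul_zero]

theorem IsTestFunction.setIntegral_pderiv (h : IsTestFunction U φ) (i : Fin 2) :
    ∫ x in U, LocalStokes.pderiv i φ x = 0 := by
  have h1 := (h.pderiv i).setIntegral_mul (fun _ => 1)
  have h2 := integral_mul_pderiv (φ := fun _ => (1 : ℝ)) contDiff_const (h.smooth.of_le (by simp))
    h.compact i
  simp only [one_mul] at h1 h2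
  rw [h1, h2]
  simp [LocalStokes.pderiv]

theorem integral_mul_eq_inner (v w : L2 U) : ∫ x in U, v x * w x = inner ℝ v w := by
  rw [L2.inner_def]
  exact integral_congr_ae (Filter.Eventually.of_forall fun x => by simp [mul_comm])

theorem integral_mul_eq_inner_toLp (v : L2 U) (hφ : MemLp φ 2 (volume.restrict U)) :
    ∫ x in U, v x * φ x = inner ℝ v (hφ.toLp φ) := by
  rw [← integral_mul_eq_inner]
  refine integral_congr_ae ?_
  filter_upwards [hφ.coeFn_toLp] with x hx
  rw [hx]

theorem norm_sub_toLp_le_iff (v : L2 U) (hφ : MemLp φ 2 (volume.restrict U)) {ε : ℝ}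
    (hε : 0 ≤ ε) : ‖v - hφ.toLp φ‖ ≤ ε ↔
      eLpNorm (fun x => v x - φ x) 2 (volume.restrict U) ≤ ENNReal.ofReal ε := by
  have h : eLpNorm (fun x => v x - φ x) 2 (volume.restrict U)
      = eLpNorm (v - hφ.toLp φ : L2 U) 2 (volume.restrict U) := by
    refine eLpNorm_congr_ae ?_
    filter_upwards [hφ.coeFn_toLp, Lp.coeFn_sub v (hφ.toLp φ)] with x hx hx'
    rw [hx', Pi.sub_apply, hx]
  rw [h, Lp.norm_def, ENNReal.le_ofReal_iff_toReal_le (Lp.eLpNorm_ne_top _) hε]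

/-- Uniqueness of weak derivatives. -/
theorem IsWeakPartial.unique (hU : IsOpen U) {i : Fin 2} {v g g' : L2 U}
    (h : IsWeakPartial U i v g) (h' : IsWeakPartial U i v g') : g = g' := by
  have key : ∀ᵐ x ∂volume, x ∈ U → (g - g' : L2 U) x = 0 := by
    refine hU.ae_eq_zero_of_integral_contDiff_smul_eq_zero ?_ fun φ h1 h2 h3 => ?_
    · have : LocallyIntegrable (g - g' : L2 U) (volume.restrict U) :=
        (Lp.memLp _).locallyIntegrable (by norm_num)
      exact (locallyIntegrableOn_of_locallyIntegrable_restrict this)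
    · have hφ : IsTestFunction U φ := ⟨h1, h2, h3⟩
      have e := hφ.setIntegral_mul (g - g' : L2 U)
      simp only [smul_eq_mul, mul_comm (φ _)]
      rw [← e, integral_mul_eq_inner_toLp _ hφ.memLp, inner_sub_left,
        ← integral_mul_eq_inner_toLp, ← integral_mul_eq_inner_toLp]
      have e1 := h φ hφ
      have e2 := h' φ hφ
      linarith
  rw [← sub_eq_zero]
  refine Lp.ext ?_
  filter_upwards [(ae_restrict_iff' hU.measurableSet).2 key, Lp.coeFn_zero ℝ 2 (volume.restrict U)]
    with x hx hx'
  rw [hx, hx', Pi.zero_apply]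

theorem isWeakPartial_weakPartial {i : Fin 2} {v g : L2 U} (h : IsWeakPartial U i v g) :
    IsWeakPartial U i v (weakPartial U i v) := by
  have h' : ∃ g, IsWeakPartial U i v g := ⟨g, h⟩
  rw [weakPartial, dif_pos h']
  exact h'.choose_spec

theorem IsWeakPartial.weakPartial_eq (hU : IsOpen U) {i : Fin 2} {v g : L2 U}
    (h : IsWeakPartial U i v g) : weakPartial U i v = g :=
  (isWeakPartial_weakPartial h).unique hU h

/-- The graph of the gradient on `C_c^∞(U)`, as a subspace of `L²(U) × L²(U)²`. -/
def testGraph (U : Set Plane) : Submodule ℝ (L2 U × (Fin 2 → L2 U)) where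
  carrier := {x | ∃ φ, IsTestFunction U φ ∧ x.1 =ᵐ[volume.restrict U] φ ∧
    ∀ i, x.2 i =ᵐ[volume.restrict U] pderiv i φ}
  add_mem' := by
    rintro x y ⟨φ, hφ, h1, h2⟩ ⟨ψ, hψ, h3, h4⟩
    refine ⟨φ + ψ, hφ.add hψ, ?_, fun i => ?_⟩
    · filter_upwards [Lp.coeFn_add x.1 y.1, h1, h3] with a e1 e2 e3
      rw [Prod.fst_add, e1, Pi.add_apply, Pi.add_apply, e2, e3]
    · filter_upwards [Lp.coeFn_add (x.2 i) (y.2 i), h2 i, h4 i] with a e1 e2 e3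
      rw [pderiv_add (hφ.smooth.differentiable (by simp)) (hψ.smooth.differentiable (by simp))]
      rw [Prod.snd_add, Pi.add_apply, e1, Pi.add_apply, e2, e3]
  zero_mem' := by
    refine ⟨0, isTestFunction_zero, Lp.coeFn_zero _ _ _, fun i => ?_⟩
    filter_upwards [Lp.coeFn_zero ℝ 2 (volume.restrict U)] with a e1
    rw [Prod.snd_zero, Pi.zero_apply, e1]
    simp [pderiv]
  smul_mem' := by
    rintro c x ⟨φ, hφ, h1, h2⟩
    have e : (fun y => c * φ y) = c • φ := rfl
    refine ⟨fun y => c * φ y, hφ.mul_left contDiff_const, ?_, fun i => ?_⟩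
    · filter_upwards [Lp.coeFn_smul c x.1, h1] with a e1 e2
      simp [e1, e2]
    · filter_upwards [Lp.coeFn_smul c (x.2 i), h2 i] with a e1 e2
      simp [e, e1, e2, pderiv, fderiv_const_smul_field]

/-- The graph of the weak gradient on `H¹₀(U)`: the closure of `testGraph U`. -/
def sobolevGraph (U : Set Plane) : Submodule ℝ (L2 U × (Fin 2 → L2 U)) :=
  (testGraph U).topologicalClosure

theorem mem_testGraph (h : IsTestFunction U φ) :
    ((h.memLp.toLp φ, fun i => (h.pderiv i).memLp.toLp _) : L2 U × (Fin 2 → L2 U))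
      ∈ testGraph U :=
  ⟨φ, h, h.memLp.coeFn_toLp, fun i => (h.pderiv i).memLp.coeFn_toLp⟩

/-- A closed condition on `L²(U) × L²(U)²` that holds for test functions holds on the graph of
the weak gradient. -/
theorem sobolevGraph_induction {P : L2 U × (Fin 2 → L2 U) → Prop} (hP : IsClosed {x | P x})
    (h : ∀ φ (hφ : IsTestFunction U φ),
      P (hφ.memLp.toLp φ, fun i => (hφ.pderiv i).memLp.toLp _))
    {x : L2 U × (Fin 2 → L2 U)} (hx : x ∈ sobolevGraph U) : P x := by
  suffices key : (testGraph U : Set (L2 U × (Fin 2 → L2 U))) ⊆ {x | P x} from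
    closure_minimal key hP hx
  rintro x ⟨φ, hφ, h1, h2⟩
  have e : x = (hφ.memLp.toLp φ, fun i => (hφ.pderiv i).memLp.toLp _) := by
    refine Prod.ext (Lp.ext ?_) (funext fun i => Lp.ext ?_)
    · exact h1.trans hφ.memLp.coeFn_toLp.symm
    · exact (h2 i).trans (hφ.pderiv i).memLp.coeFn_toLp.symm
  rw [Set.mem_ofPred_eq, e]
  exact h φ hφ

theorem isWeakPartial_of_mem_sobolevGraph {x : L2 U × (Fin 2 → L2 U)}
    (hx : x ∈ sobolevGraph U) (i : Fin 2) : IsWeakPartial U i x.1 (x.2 i) := by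
  intro ψ hψ
  refine sobolevGraph_induction
    (P := fun x => ∫ y in U, x.1 y * pderiv i ψ y = -∫ y in U, x.2 i y * ψ y) ?_ ?_ hx
  · simp only [integral_mul_eq_inner_toLp _ hψ.memLp,
      integral_mul_eq_inner_toLp _ (hψ.pderiv i).memLp]
    exact isClosed_eq (by fun_prop) (by fun_prop)
  · intro φ hφ
    have e1 : ∫ y in U, hφ.memLp.toLp φ y * pderiv i ψ y = ∫ y in U, φ y * pderiv i ψ y := by
      refine integral_congr_ae ?_
      filter_upwards [hφ.memLp.coeFn_toLp] with y hy
      rw [hy]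
    have e2 : ∫ y in U, (hφ.pderiv i).memLp.toLp _ y * ψ y = ∫ y in U, pderiv i φ y * ψ y := by
      refine integral_congr_ae ?_
      filter_upwards [(hφ.pderiv i).memLp.coeFn_toLp] with y hy
      rw [hy]
    simp only [e1, e2]
    rw [hψ.setIntegral_mul, (hψ.pderiv i).setIntegral_mul]
    exact integral_mul_pderiv (hφ.smooth.of_le (by simp)) (hψ.smooth.of_le (by simp)) hψ.compact i

theorem weakPartial_of_mem_sobolevGraph (hU : IsOpen U) {x : L2 U × (Fin 2 → L2 U)}
    (hx : x ∈ sobolevGraph U) (i : Fin 2) : weakPartial U i x.1 = x.2 i :=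
  (isWeakPartial_of_mem_sobolevGraph hx i).weakPartial_eq hU

theorem mem_H10_of_mem_sobolevGraph (hU : IsOpen U) {x : L2 U × (Fin 2 → L2 U)}
    (hx : x ∈ sobolevGraph U) : x.1 ∈ H10 U := by
  refine ⟨fun i => ⟨_, isWeakPartial_of_mem_sobolevGraph hx i⟩, fun ε hε => ?_⟩
  obtain ⟨y, ⟨φ, hφ, h1, h2⟩, hy⟩ := Metric.mem_closure_iff.1 hx ε hε
  rw [Prod.dist_eq, max_lt_iff, dist_pi_lt_iff hε] at hy
  refine ⟨φ, hφ, ?_, fun i => ?_⟩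
  · rw [← norm_sub_toLp_le_iff _ hφ.memLp hε.le]
    have : hφ.memLp.toLp φ = y.1 := Lp.ext (hφ.memLp.coeFn_toLp.trans h1.symm)
    rw [this, ← dist_eq_norm]
    exact hy.1.le
  · rw [weakPartial_of_mem_sobolevGraph hU hx i,
      ← norm_sub_toLp_le_iff _ (hφ.pderiv i).memLp hε.le]
    have : (hφ.pderiv i).memLp.toLp _ = y.2 i :=
      Lp.ext ((hφ.pderiv i).memLp.coeFn_toLp.trans (h2 i).symm)
    rw [this, ← dist_eq_norm]
    exact (hy.2 i).le

theorem mem_sobolevGraph_of_mem_H10 {v : L2 U} (hv : v ∈ H10 U) :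
    ((v, fun i => weakPartial U i v) : L2 U × (Fin 2 → L2 U)) ∈ sobolevGraph U := by
  refine Metric.mem_closure_iff.2 fun ε hε => ?_
  obtain ⟨φ, hφ, h1, h2⟩ := hv.2 (ε / 2) (by positivity)
  refine ⟨_, mem_testGraph hφ, ?_⟩
  rw [← norm_sub_toLp_le_iff _ hφ.memLp (by positivity)] at h1
  have h2' : ∀ i, ‖weakPartial U i v - (hφ.pderiv i).memLp.toLp _‖ ≤ ε / 2 := fun i => by
    rw [norm_sub_toLp_le_iff _ (hφ.pderiv i).memLp (by positivity)]
    exact h2 i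
  rw [Prod.dist_eq, max_lt_iff, dist_pi_lt_iff hε]
  refine ⟨?_, fun i => ?_⟩
  · rw [dist_eq_norm]; exact h1.trans_lt (by linarith)
  · rw [dist_eq_norm]; exact (h2' i).trans_lt (by linarith)

theorem setIntegral_eq_zero_of_mem_sobolevGraph (hU : volume U ≠ ⊤) {x : L2 U × (Fin 2 → L2 U)}
    (hx : x ∈ sobolevGraph U) (i : Fin 2) : ∫ y in U, x.2 i y = 0 := by
  have : IsFiniteMeasure (volume.restrict U) := ⟨by simpa using hU.lt_top⟩
  have h1 : MemLp (fun _ : Plane => (1 : ℝ)) 2 (volume.restrict U) := memLp_const _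
  have e : ∀ v : L2 U, ∫ y in U, v y = inner ℝ v (h1.toLp _) := fun v => by
    rw [← integral_mul_eq_inner_toLp]; simp
  refine sobolevGraph_induction (P := fun x => ∫ y in U, x.2 i y = 0) ?_ ?_ hx
  · simp only [e]
    exact isClosed_eq (by fun_prop) (by fun_prop)
  · intro φ hφ
    rw [← hφ.setIntegral_pderiv i]
    exact integral_congr_ae (hφ.pderiv i).memLp.coeFn_toLp

/-- Poincaré's inequality on a bounded set. For test functions it follows from integrating the
derivative of `x₀ φ²`. -/
theorem norm_le_of_mem_sobolevGraph {R : ℝ} (hR : ∀ x ∈ U, |x 0| ≤ R) {x : L2 U × (Fin 2 → L2 U)}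
    (hx : x ∈ sobolevGraph U) : ‖x.1‖ ≤ 2 * R * ‖x.2 0‖ := by
  refine sobolevGraph_induction (P := fun x => ‖x.1‖ ≤ 2 * R * ‖x.2 0‖) ?_ ?_ hx
  · exact isClosed_le (by fun_prop) (by fun_prop)
  · intro φ hφ
    dsimp only
    rcases U.eq_empty_or_nonempty with rfl | ⟨z, hz⟩
    · have : hφ.memLp.toLp φ = 0 := Lp.ext (by simp [Filter.EventuallyEq])
      have h2 : (hφ.pderiv 0).memLp.toLp _ = 0 := Lp.ext (by simp [Filter.EventuallyEq])
      rw [this, h2]; simp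
    have hR0 : 0 ≤ R := (abs_nonneg _).trans (hR z hz)
    set Φ := hφ.memLp.toLp φ with hΦ
    set Ψ := (hφ.pderiv 0).memLp.toLp _ with hΨ
    have hc : ContDiff ℝ ∞ (fun y : Plane => y 0) := by fun_prop
    -- integrate by parts `x₀ ∂₀(φ²)`
    have key := integral_mul_pderiv (hc.of_le (by simp)) ((hφ.mul_left hφ.smooth).smooth.of_le
      (by simp)) (hφ.mul_left hφ.smooth).compact 0
    simp only [pderiv_coord, if_true, pderiv_mul (hφ.smooth.differentiable (by simp))
      (hφ.smooth.differentiable (by simp)), one_mul] at key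
    have e1 : ‖Φ‖ ^ 2 = ∫ y, φ y * φ y := by
      rw [← real_inner_self_eq_norm_sq, ← integral_mul_eq_inner_toLp, ← hφ.setIntegral_mul]
      refine integral_congr_ae ?_
      filter_upwards [hφ.memLp.coeFn_toLp] with y hy
      rw [hy]
    have hXm : IsTestFunction U (fun y => y 0 * φ y) := hφ.mul_left hc
    set X := hXm.memLp.toLp _ with hX
    have e2 : ∫ y, y 0 * (φ y * pderiv 0 φ y + φ y * pderiv 0 φ y) = 2 * inner ℝ X Ψ := by
      rw [← integral_mul_eq_inner_toLp, ← integral_const_mul]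
      have : ∫ y in U, 2 * (X y * pderiv 0 φ y) = ∫ y in U, (2 * (y 0 * φ y)) * pderiv 0 φ y := by
        refine integral_congr_ae ?_
        filter_upwards [hXm.memLp.coeFn_toLp] with y hy
        rw [hy]; ring
      rw [this, (hφ.pderiv 0).setIntegral_mul]
      exact integral_congr_ae (Filter.Eventually.of_forall fun y => by ring_nf)
    have e3 : ‖X‖ ≤ R * ‖Φ‖ := by
      refine Lp.norm_le_mul_norm_of_ae_le_mul ?_
      filter_upwards [hXm.memLp.coeFn_toLp, hφ.memLp.coeFn_toLp,
        ae_restrict_of_ae_restrict_of_subset subset_closure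
          (ae_restrict_mem isClosed_closure.measurableSet)] with y h1 h2 h3
      rw [h1, h2, norm_mul]
      refine mul_le_mul_of_nonneg_right ?_ (norm_nonneg _)
      have hcl : closure U ⊆ {y : Plane | |y 0| ≤ R} :=
        closure_minimal hR (isClosed_le (by fun_prop) continuous_const)
      exact hcl h3
    have e4 : ‖Φ‖ ^ 2 ≤ 2 * (R * ‖Φ‖ * ‖Ψ‖) := by
      have := abs_real_inner_le_norm X Ψ
      have h5 : ‖X‖ * ‖Ψ‖ ≤ R * ‖Φ‖ * ‖Ψ‖ := mul_le_mul_of_nonneg_right e3 (norm_nonneg _)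
      have h6 := neg_abs_le (inner ℝ X Ψ)
      rw [e1]
      linarith [key.symm.trans e2]
    by_cases h0 : ‖Φ‖ = 0
    · rw [h0]; positivity
    · have : 0 < ‖Φ‖ := lt_of_le_of_ne (norm_nonneg _) (Ne.symm h0)
      nlinarith

end Sobolev

/-! ### The space `H¹₀` -/

section SobolevZero

open Filter Topology

variable {U V Ω : Set Plane}

/-- Bounded convergence in `L²(U)`. -/
theorem tendsto_toLp_of_bounded (hU : volume U ≠ ⊤) {f : ℕ → Plane → ℝ}
    (hf : ∀ n, MemLp (f n) 2 (volume.restrict U)) {v : L2 U} (C : ℝ)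
    (hb : ∀ n, ∀ᵐ x ∂(volume.restrict U), |f n x| ≤ C)
    (hv : ∀ᵐ x ∂(volume.restrict U), Tendsto (fun n => f n x) atTop (𝓝 (v x))) :
    Tendsto (fun n => (hf n).toLp (f n)) atTop (𝓝 v) := by
  have : IsFiniteMeasure (volume.restrict U) := ⟨by simpa using hU.lt_top⟩
  have hvC : ∀ᵐ x ∂(volume.restrict U), |v x| ≤ C := by
    filter_upwards [hv, ae_all_iff.2 hb] with x h1 h2
    exact le_of_tendsto h1.abs (Eventually.of_forall h2)
  have key : Tendsto (fun n => ∫ x in U, (f n x - v x) ^ 2) atTop (𝓝 (∫ _ in U, (0 : ℝ))) := by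
    refine tendsto_integral_of_dominated_convergence (fun _ => (2 * C) ^ 2) (fun n => ?_)
      (integrable_const _) (fun n => ?_) ?_
    · exact ((hf n).aestronglyMeasurable.sub (Lp.aestronglyMeasurable v)).pow 2
    · filter_upwards [hb n, hvC] with x h1 h2
      rw [Real.norm_eq_abs, abs_pow]
      exact pow_le_pow_left₀ (abs_nonneg _) ((abs_sub _ _).trans (by linarith)) 2
    · filter_upwards [hv] with x hx
      simpa using (hx.sub_const (v x)).pow 2
  rw [integral_zero] at key
  rw [tendsto_iff_norm_sub_tendsto_zero]
  have e : ∀ n, ‖(hf n).toLp (f n) - v‖ = Real.sqrt (∫ x in U, (f n x - v x) ^ 2) := fun n => by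
    rw [← Real.sqrt_sq (norm_nonneg _), ← real_inner_self_eq_norm_sq, ← integral_mul_eq_inner]
    congr 1
    refine integral_congr_ae ?_
    filter_upwards [Lp.coeFn_sub ((hf n).toLp (f n)) v, (hf n).coeFn_toLp] with x h1 h2
    rw [h1, Pi.sub_apply, h2, sq]
  simp only [e]
  simpa using key.sqrt

/-- A pointwise limit of test functions, with bounded values and gradients, is in `H¹₀(U)` if the
gradients converge almost everywhere. -/
theorem mem_sobolevGraph_of_tendsto (hU : volume U ≠ ⊤) {φ : ℕ → Plane → ℝ}
    (hφ : ∀ n, IsTestFunction U (φ n)) {v : L2 U} {g : Fin 2 → L2 U} (C : ℝ)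
    (hb : ∀ n, ∀ x ∈ U, |φ n x| ≤ C) (hb' : ∀ n i, ∀ x ∈ U, |pderiv i (φ n) x| ≤ C)
    (hv : ∀ᵐ x ∂(volume.restrict U), Tendsto (fun n => φ n x) atTop (𝓝 (v x)))
    (hg : ∀ i, ∀ᵐ x ∂(volume.restrict U),
      Tendsto (fun n => pderiv i (φ n) x) atTop (𝓝 (g i x))) :
    ((v, g) : L2 U × (Fin 2 → L2 U)) ∈ sobolevGraph U := by
  have hm : ∀ {p : Plane → ℝ}, Continuous p → (∀ x ∈ U, |p x| ≤ C) →
      ∀ᵐ x ∂(volume.restrict U), |p x| ≤ C := fun {p} hp h => by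
    have hcl : closure U ⊆ {y : Plane | |p y| ≤ C} :=
      closure_minimal h (isClosed_le (by fun_prop) continuous_const)
    filter_upwards [ae_restrict_of_ae_restrict_of_subset subset_closure
      (ae_restrict_mem isClosed_closure.measurableSet)] with x hx
    exact hcl hx
  refine mem_closure_of_tendsto (b := atTop) (f := fun n => (((hφ n).memLp.toLp _,
    fun i => ((hφ n).pderiv i).memLp.toLp _) : L2 U × (Fin 2 → L2 U))) ?_
    (Eventually.of_forall fun n => mem_testGraph (hφ n))
  refine Tendsto.prodMk_nhds ?_ (tendsto_pi_nhds.2 fun i => ?_)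
  · exact tendsto_toLp_of_bounded hU _ C (fun n => hm (hφ n).smooth.continuous (hb n)) hv
  · exact tendsto_toLp_of_bounded hU _ C
      (fun n => hm ((hφ n).pderiv i).smooth.continuous (hb' n i)) (hg i)

theorem mem_H10_iff (hU : IsOpen U) {v : L2 U} :
    v ∈ H10 U ↔ ((v, fun i => weakPartial U i v) : L2 U × (Fin 2 → L2 U)) ∈ sobolevGraph U :=
  ⟨mem_sobolevGraph_of_mem_H10, fun h => mem_H10_of_mem_sobolevGraph hU h⟩

/-- `H¹₀(U)` as a subspace of `L²(U)`. -/
def sobolevZero (U : Set Plane) : Submodule ℝ (L2 U) :=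
  (sobolevGraph U).map (LinearMap.fst ℝ _ _)

theorem mem_sobolevZero (hU : IsOpen U) {v : L2 U} : v ∈ sobolevZero U ↔ v ∈ H10 U := by
  refine ⟨?_, fun h => ⟨_, (mem_H10_iff hU).1 h, rfl⟩⟩
  rintro ⟨x, hx, rfl⟩
  exact mem_H10_of_mem_sobolevGraph hU hx

theorem weakPartial_add (hU : IsOpen U) {v w : L2 U} (hv : v ∈ H10 U) (hw : w ∈ H10 U)
    (i : Fin 2) : weakPartial U i (v + w) = weakPartial U i v + weakPartial U i w :=
  weakPartial_of_mem_sobolevGraph hU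
    ((sobolevGraph U).add_mem ((mem_H10_iff hU).1 hv) ((mem_H10_iff hU).1 hw)) i

theorem weakPartial_smul (hU : IsOpen U) {v : L2 U} (hv : v ∈ H10 U) (c : ℝ)
    (i : Fin 2) : weakPartial U i (c • v) = c • weakPartial U i v :=
  weakPartial_of_mem_sobolevGraph hU ((sobolevGraph U).smul_mem c ((mem_H10_iff hU).1 hv)) i

theorem setIntegral_weakPartial (hU : IsOpen U) (hU' : volume U ≠ ⊤) {v : L2 U} (hv : v ∈ H10 U)
    (i : Fin 2) : ∫ x in U, weakPartial U i v x = 0 :=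
  setIntegral_eq_zero_of_mem_sobolevGraph hU' ((mem_H10_iff hU).1 hv) i

theorem eq_zero_of_weakPartial_eq_zero (hU : IsOpen U) (hb : Bornology.IsBounded U) {v : L2 U}
    (hv : v ∈ H10 U) (h : weakPartial U 0 v = 0) : v = 0 := by
  obtain ⟨R, hR⟩ := hb.exists_norm_le
  have := norm_le_of_mem_sobolevGraph
    (fun x hx => (PiLp.norm_apply_le x 0).trans (hR x hx)) ((mem_H10_iff hU).1 hv)
  simpa [h] using this

/-! ### Extension by zero and restriction -/

theorem coeFn_zeroExtend (hV : IsOpen V) (v : L2 V) :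
    zeroExtend Ω hV v =ᵐ[volume.restrict Ω] V.indicator v :=
  (memLp_indicator hV v).coeFn_toLp

theorem indicator_ae_eq (hV : IsOpen V) {f g : Plane → ℝ} (h : f =ᵐ[volume.restrict V] g) :
    V.indicator f =ᵐ[volume.restrict Ω] V.indicator g := by
  refine ae_restrict_of_ae ?_
  filter_upwards [(ae_restrict_iff' hV.measurableSet).1 h] with x hx
  by_cases hxV : x ∈ V
  · simp [hxV, hx hxV]
  · simp [hxV]

/-- Extension by zero as a linear isometry. -/
def zeroExtendₗᵢ (hV : IsOpen V) (h : V ⊆ Ω) : L2 V →ₗᵢ[ℝ] L2 Ω where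
  toFun := zeroExtend Ω hV
  map_add' v w := by
    refine Lp.ext ?_
    filter_upwards [coeFn_zeroExtend (Ω := Ω) hV v, coeFn_zeroExtend (Ω := Ω) hV w,
      coeFn_zeroExtend (Ω := Ω) hV (v + w), indicator_ae_eq (Ω := Ω) hV (Lp.coeFn_add v w),
      Lp.coeFn_add (zeroExtend Ω hV v) (zeroExtend Ω hV w)] with x h1 h2 h3 h4 h5
    rw [h3, h4, h5, Pi.add_apply, h1, h2, Set.indicator_add']
    rfl
  map_smul' c v := by
    refine Lp.ext ?_
    filter_upwards [coeFn_zeroExtend (Ω := Ω) hV v,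
      coeFn_zeroExtend (Ω := Ω) hV (c • v), indicator_ae_eq (Ω := Ω) hV (Lp.coeFn_smul c v),
      Lp.coeFn_smul c (zeroExtend Ω hV v)] with x h1 h3 h4 h5
    rw [h3, h4, RingHom.id_apply, h5, Pi.smul_apply, h1]
    exact Set.indicator_const_smul_apply V c v x
  norm_map' v := by
    change ‖zeroExtend Ω hV v‖ = ‖v‖
    rw [zeroExtend, Lp.norm_toLp, eLpNorm_indicator_eq_eLpNorm_restrict hV.measurableSet,
      Measure.restrict_restrict hV.measurableSet, Set.inter_eq_left.2 h, Lp.norm_def]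

theorem coe_zeroExtendₗᵢ (hV : IsOpen V) (h : V ⊆ Ω) (v : L2 V) :
    zeroExtendₗᵢ hV h v = zeroExtend Ω hV v := rfl

theorem coeFn_restrictL2 (h : V ⊆ Ω) (q : L2 Ω) : restrictL2 h q =ᵐ[volume.restrict V] q :=
  MemLp.coeFn_toLp _

theorem restrictL2_zeroExtend (hV : IsOpen V) (h : V ⊆ Ω) (v : L2 V) :
    restrictL2 h (zeroExtend Ω hV v) = v := by
  refine Lp.ext ?_
  filter_upwards [coeFn_restrictL2 h (zeroExtend Ω hV v), ae_restrict_mem hV.measurableSet,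
    ae_restrict_of_ae_restrict_of_subset h (coeFn_zeroExtend (Ω := Ω) hV v)] with x h1 h2 h3
  rw [h1, h3, Set.indicator_of_mem h2]

theorem restrictL2_add (h : V ⊆ Ω) (p q : L2 Ω) :
    restrictL2 h (p + q) = restrictL2 h p + restrictL2 h q := by
  refine Lp.ext ?_
  filter_upwards [coeFn_restrictL2 h p, coeFn_restrictL2 h q, coeFn_restrictL2 h (p + q),
    Lp.coeFn_add (restrictL2 h p) (restrictL2 h q),
    ae_restrict_of_ae_restrict_of_subset h (Lp.coeFn_add p q)] with x h1 h2 h3 h4 h5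
  rw [h3, h4, h5, Pi.add_apply, Pi.add_apply, h1, h2]

theorem restrictL2_smul (h : V ⊆ Ω) (c : ℝ) (q : L2 Ω) :
    restrictL2 h (c • q) = c • restrictL2 h q := by
  refine Lp.ext ?_
  filter_upwards [coeFn_restrictL2 h q, coeFn_restrictL2 h (c • q),
    Lp.coeFn_smul c (restrictL2 h q),
    ae_restrict_of_ae_restrict_of_subset h (Lp.coeFn_smul c q)] with x h1 h3 h4 h5
  rw [h3, h4, h5, Pi.smul_apply, Pi.smul_apply, h1]

/-- Extension by zero maps `H¹₀(V)` to `H¹₀(Ω)` and commutes with the gradient, because it does so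
for test functions. -/
theorem zeroExtend_mem_sobolevGraph (hV : IsOpen V) (h : V ⊆ Ω) {x : L2 V × (Fin 2 → L2 V)}
    (hx : x ∈ sobolevGraph V) :
    ((zeroExtend Ω hV x.1, fun i => zeroExtend Ω hV (x.2 i)) : L2 Ω × (Fin 2 → L2 Ω))
      ∈ sobolevGraph Ω := by
  simp only [← coe_zeroExtendₗᵢ hV h]
  refine sobolevGraph_induction (P := fun x => ((zeroExtendₗᵢ hV h x.1,
    fun i => zeroExtendₗᵢ hV h (x.2 i)) : L2 Ω × (Fin 2 → L2 Ω)) ∈ sobolevGraph Ω) ?_ ?_ hx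
  · exact (Submodule.isClosed_topologicalClosure _).preimage (by fun_prop)
  · intro φ hφ
    have aux : ∀ {p : Plane → ℝ} (hp : IsTestFunction V p),
        zeroExtend Ω hV (hp.memLp.toLp p) =ᵐ[volume.restrict Ω] p := fun {p} hp => by
      filter_upwards [coeFn_zeroExtend (Ω := Ω) hV (hp.memLp.toLp p),
        indicator_ae_eq (Ω := Ω) hV hp.memLp.coeFn_toLp] with y h1 h2
      rw [h1, h2, Set.indicator_eq_self.2]
      exact (subset_tsupport p).trans hp.support
    exact subset_closure ⟨φ, ⟨hφ.smooth, hφ.compact, hφ.support.trans h⟩, aux hφ,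
      fun i => aux (hφ.pderiv i)⟩

theorem zeroExtend_mem_H10 (hΩ : IsOpen Ω) (hV : IsOpen V) (h : V ⊆ Ω) {v : L2 V}
    (hv : v ∈ H10 V) : zeroExtend Ω hV v ∈ H10 Ω :=
  mem_H10_of_mem_sobolevGraph hΩ (zeroExtend_mem_sobolevGraph hV h ((mem_H10_iff hV).1 hv))

theorem weakPartial_zeroExtend (hΩ : IsOpen Ω) (hV : IsOpen V) (h : V ⊆ Ω) {v : L2 V}
    (hv : v ∈ H10 V) (i : Fin 2) :
    weakPartial Ω i (zeroExtend Ω hV v) = zeroExtend Ω hV (weakPartial V i v) :=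
  weakPartial_of_mem_sobolevGraph hΩ (zeroExtend_mem_sobolevGraph hV h ((mem_H10_iff hV).1 hv)) i

end SobolevZero

/-! ### Polynomials and piecewise polynomials -/

section Poly

/-- The polynomial function on the plane defined by `P`. -/
def polyFun (P : MvPolynomial (Fin 2) ℝ) (x : Plane) : ℝ := MvPolynomial.eval (fun i => x i) P

@[simp] theorem polyFun_C (c : ℝ) : polyFun (MvPolynomial.C c) = fun _ => c := by
  ext; simp [polyFun]

@[simp] theorem polyFun_X (i : Fin 2) : polyFun (MvPolynomial.X i) = fun x => x i := by
  ext; simp [polyFun]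

@[simp] theorem polyFun_add (P Q : MvPolynomial (Fin 2) ℝ) :
    polyFun (P + Q) = fun x => polyFun P x + polyFun Q x := by
  ext; simp [polyFun]

@[simp] theorem polyFun_mul (P Q : MvPolynomial (Fin 2) ℝ) :
    polyFun (P * Q) = fun x => polyFun P x * polyFun Q x := by
  ext; simp [polyFun]

theorem contDiff_polyFun (P : MvPolynomial (Fin 2) ℝ) : ContDiff ℝ ∞ (polyFun P) := by
  induction P using MvPolynomial.induction_on with
  | C a => rw [polyFun_C]; exact contDiff_const
  | add p q hp hq => rw [polyFun_add]; exact hp.add hq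
  | mul_X p i hp => rw [polyFun_mul, polyFun_X]; exact hp.mul (by fun_prop)

theorem pderiv_polyFun (i : Fin 2) (P : MvPolynomial (Fin 2) ℝ) (x : Plane) :
    pderiv i (polyFun P) x = polyFun (MvPolynomial.pderiv i P) x := by
  induction P using MvPolynomial.induction_on with
  | C a => simp [pderiv, polyFun]
  | add p q hp hq =>
    have h := pderiv_add ((contDiff_polyFun p).differentiable (by simp))
      ((contDiff_polyFun q).differentiable (by simp)) i x
    rw [map_add, polyFun_add, polyFun_add]
    rw [hp, hq] at h
    exact h
  | mul_X p j hp =>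
    rw [polyFun_mul, pderiv_mul ((contDiff_polyFun p).differentiable (by simp))
      ((contDiff_polyFun _).differentiable (by simp)), hp, MvPolynomial.pderiv_mul, polyFun_X,
      pderiv_coord, MvPolynomial.pderiv_X]
    by_cases hij : i = j
    · subst hij; simp [polyFun]; ring
    · simp [polyFun, hij, Ne.symm hij]; ring

theorem totalDegree_pderiv_le (i : Fin 2) (P : MvPolynomial (Fin 2) ℝ) :
    (MvPolynomial.pderiv i P).totalDegree ≤ P.totalDegree - 1 := by
  conv_lhs => rw [P.as_sum, map_sum]
  refine MvPolynomial.totalDegree_finsetSum_le fun s hs => ?_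
  rw [MvPolynomial.pderiv_monomial]
  by_cases h : s i = 0
  · simp [h]
  · have h1 := MvPolynomial.le_totalDegree hs
    refine (MvPolynomial.totalDegree_monomial_le _ _).trans ?_
    rw [Finsupp.sum_fintype _ _ (by simp), Fin.sum_univ_two] at h1 ⊢
    fin_cases i <;> simp at h h1 ⊢ <;> omega

variable {U : Set Plane} {𝒯 : Set (Set Plane)} {n : ℕ}

theorem mem_piecewisePoly {v : L2 U} : v ∈ piecewisePoly U 𝒯 n ↔
    ∀ T ∈ 𝒯, ∃ P : MvPolynomial (Fin 2) ℝ, P.totalDegree ≤ n ∧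
      ∀ᵐ x ∂(volume.restrict U), x ∈ T → v x = polyFun P x := Iff.rfl

/-- `piecewisePoly U 𝒯 n` as a subspace. -/
def piecewisePolySub (U : Set Plane) (𝒯 : Set (Set Plane)) (n : ℕ) : Submodule ℝ (L2 U) where
  carrier := piecewisePoly U 𝒯 n
  add_mem' := by
    intro v w hv hw T hT
    obtain ⟨P, hP, hvP⟩ := hv T hT
    obtain ⟨Q, hQ, hwQ⟩ := hw T hT
    refine ⟨P + Q, (MvPolynomial.totalDegree_add P Q).trans (max_le hP hQ), ?_⟩
    filter_upwards [hvP, hwQ, Lp.coeFn_add v w] with x h1 h2 h3 hx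
    rw [h3, Pi.add_apply, h1 hx, h2 hx, map_add]
  zero_mem' := by
    intro T hT
    refine ⟨0, by simp, ?_⟩
    filter_upwards [Lp.coeFn_zero ℝ 2 (volume.restrict U)] with x h1 _
    rw [h1, Pi.zero_apply, map_zero]
  smul_mem' := by
    intro c v hv T hT
    obtain ⟨P, hP, hvP⟩ := hv T hT
    refine ⟨c • P, (MvPolynomial.totalDegree_smul_le c P).trans hP, ?_⟩
    filter_upwards [hvP, Lp.coeFn_smul c v] with x h1 h3 hx
    rw [h3, Pi.smul_apply, h1 hx, MvPolynomial.smul_eval, smul_eq_mul]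

/-- The weak derivatives of a piecewise polynomial in `H¹(U)` are its piecewise derivatives. -/
theorem weakPartial_mem_piecewisePoly (hU : IsOpen U) (h𝒯 : ∀ T ∈ 𝒯, Convex ℝ T) {v : L2 U}
    (hv : v ∈ piecewisePoly U 𝒯 n) {i : Fin 2} {g : L2 U} (hg : IsWeakPartial U i v g) :
    g ∈ piecewisePoly U 𝒯 (n - 1) := by
  intro T hT
  obtain ⟨P, hP, hvP⟩ := hv T hT
  refine ⟨MvPolynomial.pderiv i P, (totalDegree_pderiv_le i P).trans (by omega), ?_⟩
  have hO : IsOpen (U ∩ interior T) := hU.inter isOpen_interior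
  have hcont : Continuous (polyFun (MvPolynomial.pderiv i P)) := (contDiff_polyFun _).continuous
  have key : ∀ᵐ x, x ∈ U ∩ interior T → g x - polyFun (MvPolynomial.pderiv i P) x = 0 := by
    refine hO.ae_eq_zero_of_integral_contDiff_smul_eq_zero ?_ fun φ h1 h2 h3 => ?_
    · refine LocallyIntegrableOn.sub ?_ (hcont.locallyIntegrable.locallyIntegrableOn _)
      have : LocallyIntegrable g (volume.restrict U) :=
        (Lp.memLp g).locallyIntegrable (by norm_num)
      exact (locallyIntegrableOn_of_locallyIntegrable_restrict this).mono_set Set.inter_subset_left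
    · have hφ : IsTestFunction U φ := ⟨h1, h2, h3.trans Set.inter_subset_left⟩
      have e1 := hg φ hφ
      rw [hφ.setIntegral_mul, (hφ.pderiv i).setIntegral_mul] at e1
      -- on the support of `φ`, the function `v` is the polynomial `P`
      have e2 : ∫ x, v x * pderiv i φ x = ∫ x, polyFun P x * pderiv i φ x := by
        refine integral_congr_ae ?_
        filter_upwards [(ae_restrict_iff' hU.measurableSet).1 hvP] with x hx
        by_cases hx' : x ∈ U ∩ interior T
        · simp only [hx hx'.1 (interior_subset hx'.2)]; rfl
        · rw [image_eq_zero_of_notMem_tsupport fun h =>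
            hx' (h3 (tsupport_pderiv_subset i φ h)), mul_zero, mul_zero]
      rw [e2, integral_mul_pderiv ((contDiff_polyFun P).of_le (by simp)) (h1.of_le (by simp)) h2,
        neg_inj] at e1
      simp only [pderiv_polyFun] at e1
      have i1 : Integrable fun x => g x * φ x := by
        have := ((Lp.memLp g).integrable_mul hφ.memLp)
        refine (integrableOn_iff_integrable_of_support_subset (s := U) ?_).1 this
        intro x hx
        by_contra hxU
        exact hx (by simp [image_eq_zero_of_notMem_tsupport fun h => hxU (h3 h).1])
      have i2 : Integrable fun x => polyFun (MvPolynomial.pderiv i P) x * φ x :=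
        (hcont.mul h1.continuous).integrable_of_hasCompactSupport h2.mul_left
      have e3 : ∀ x, φ x • (g x - polyFun (MvPolynomial.pderiv i P) x)
          = g x * φ x - polyFun (MvPolynomial.pderiv i P) x * φ x := fun x => by
        rw [smul_eq_mul]; ring
      simp only [e3]
      rw [integral_sub i1 i2, e1, sub_self]
  have hfr := measure_eq_zero_iff_ae_notMem.1 ((h𝒯 T hT).addHaar_frontier volume)
  filter_upwards [ae_restrict_of_ae key, ae_restrict_of_ae hfr, ae_restrict_mem hU.measurableSet]
    with x h1 h2 h3 hxT
  have hint : x ∈ interior T := by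
    by_contra hx
    exact h2 ⟨subset_closure hxT, hx⟩
  exact sub_eq_zero.1 (h1 ⟨h3, hint⟩)

end Poly

/-! ### Discrete velocity spaces, gradient and divergence -/

section Velocity

variable {U : Set Plane} {𝒯 : Set (Set Plane)} {n : ℕ}

/-- Vector fields whose components are piecewise polynomials of degree at most `n` in `H¹₀(U)`. -/
def velocity (U : Set Plane) (𝒯 : Set (Set Plane)) (n : ℕ) : Submodule ℝ (Fin 2 → L2 U) :=
  Submodule.pi Set.univ fun _ => piecewisePolySub U 𝒯 n ⊓ sobolevZero U

theorem mem_velocity (hU : IsOpen U) {u : Fin 2 → L2 U} :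
    u ∈ velocity U 𝒯 n ↔ ∀ i, u i ∈ piecewisePoly U 𝒯 n ∩ H10 U := by
  simp only [velocity, Submodule.mem_pi, Set.mem_univ, true_imp_iff, Submodule.mem_inf,
    mem_sobolevZero hU]
  rfl

/-- The gradient of a velocity field. The codomain carries the Hilbert space structure in which
its norm is `gradNorm`. -/
def gradₗ (hU : IsOpen U) : velocity U 𝒯 n →ₗ[ℝ] PiLp 2 fun _ : Fin 2 × Fin 2 => L2 U where
  toFun u := WithLp.toLp 2 fun ij => weakPartial U ij.2 (u.1 ij.1)
  map_add' u v := by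
    ext1 ij
    exact weakPartial_add hU ((mem_velocity hU).1 u.2 ij.1).2 ((mem_velocity hU).1 v.2 ij.1).2 ij.2
  map_smul' c u := by
    ext1 ij
    exact weakPartial_smul hU ((mem_velocity hU).1 u.2 ij.1).2 c ij.2

/-- The divergence of a velocity field. -/
def divₗ (hU : IsOpen U) : velocity U 𝒯 n →ₗ[ℝ] L2 U where
  toFun u := divergence U u
  map_add' u v := by
    simp only [divergence, ← Finset.sum_add_distrib]
    exact Finset.sum_congr rfl fun i _ =>
      weakPartial_add hU ((mem_velocity hU).1 u.2 i).2 ((mem_velocity hU).1 v.2 i).2 i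
  map_smul' c u := by
    simp only [divergence, Finset.smul_sum, RingHom.id_apply]
    exact Finset.sum_congr rfl fun i _ => weakPartial_smul hU ((mem_velocity hU).1 u.2 i).2 c i

theorem divₗ_apply (hU : IsOpen U) (u : velocity U 𝒯 n) : divₗ hU u = divergence U u := rfl

theorem gradₗ_apply (hU : IsOpen U) (u : velocity U 𝒯 n) (i j : Fin 2) :
    gradₗ hU u (i, j) = weakPartial U j (u.1 i) := rfl

theorem norm_gradₗ (hU : IsOpen U) (u : velocity U 𝒯 n) : ‖gradₗ hU u‖ = gradNorm U u := by
  rw [PiLp.norm_eq_of_L2, Fintype.sum_prod_type]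
  rfl

theorem inner_gradₗ (hU : IsOpen U) (u v : velocity U 𝒯 n) :
    inner ℝ (gradₗ hU u) (gradₗ hU v) = gradInner U u v := by
  rw [PiLp.inner_apply, Fintype.sum_prod_type]
  simp only [gradInner, integral_mul_eq_inner]
  rfl

/-- By Poincaré's inequality, the gradient is injective on velocities. -/
theorem eq_zero_of_gradₗ_eq_zero (hU : IsOpen U) (hb : Bornology.IsBounded U)
    (u : velocity U 𝒯 n) (h : gradₗ hU u = 0) : u = 0 := by
  ext1
  funext i
  refine eq_zero_of_weakPartial_eq_zero hU hb ((mem_velocity hU).1 u.2 i).2 ?_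
  rw [← gradₗ_apply hU, h]
  rfl

theorem memLp_of_continuous (hb : Bornology.IsBounded U) {f : Plane → ℝ} (hf : Continuous f) :
    MemLp f 2 (volume.restrict U) := by
  have : IsFiniteMeasure (volume.restrict U) := ⟨by simpa using hb.measure_lt_top⟩
  obtain ⟨C, hC⟩ := hb.isCompact_closure.exists_bound_of_continuousOn hf.continuousOn
  refine MemLp.of_bound hf.aestronglyMeasurable C ?_
  filter_upwards [ae_restrict_of_ae_restrict_of_subset subset_closure
      (ae_restrict_mem isClosed_closure.measurableSet)] with x hx
  exact hC x hx

theorem L2_integrable (hb : Bornology.IsBounded U) (q : L2 U) :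
    Integrable q (volume.restrict U) := by
  have : IsFiniteMeasure (volume.restrict U) := ⟨by simpa using hb.measure_lt_top⟩
  exact (Lp.memLp q).integrable (by norm_num)

/-- Pressures: piecewise polynomials of degree at most `n` with zero mean. -/
def pressureSub (hb : Bornology.IsBounded U) (𝒯 : Set (Set Plane)) (n : ℕ) :
    Submodule ℝ (L2 U) where
  carrier := piecewisePoly U 𝒯 n ∩ L2Zero U
  add_mem' := by
    rintro p q ⟨hp, hp'⟩ ⟨hq, hq'⟩
    refine ⟨(piecewisePolySub U 𝒯 n).add_mem hp hq, ?_⟩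
    rw [L2Zero, Set.mem_ofPred_eq] at *
    rw [integral_congr_ae (Lp.coeFn_add p q)]
    simp only [Pi.add_apply]
    rw [integral_add (L2_integrable hb p) (L2_integrable hb q), hp', hq', add_zero]
  zero_mem' := by
    refine ⟨(piecewisePolySub U 𝒯 n).zero_mem, ?_⟩
    rw [L2Zero, Set.mem_ofPred_eq, integral_congr_ae (Lp.coeFn_zero ℝ 2 _)]
    simp
  smul_mem' := by
    rintro c p ⟨hp, hp'⟩
    refine ⟨(piecewisePolySub U 𝒯 n).smul_mem c hp, ?_⟩
    rw [L2Zero, Set.mem_ofPred_eq] at *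
    rw [integral_congr_ae (Lp.coeFn_smul c p)]
    simp only [Pi.smul_apply, smul_eq_mul]
    rw [integral_const_mul, hp', mul_zero]

theorem divₗ_mem_pressureSub (hU : IsOpen U) (hb : Bornology.IsBounded U)
    (h𝒯 : ∀ T ∈ 𝒯, Convex ℝ T) (u : velocity U 𝒯 n) :
    divₗ hU u ∈ pressureSub hb 𝒯 (n - 1) := by
  refine (pressureSub hb 𝒯 (n - 1)).sum_mem
    (f := fun i => weakPartial U i (u.1 i)) fun i _ => ?_
  obtain ⟨h1, h2⟩ := (mem_velocity hU).1 u.2 i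
  exact ⟨weakPartial_mem_piecewisePoly hU h𝒯 h1
    (isWeakPartial_of_mem_sobolevGraph ((mem_H10_iff hU).1 h2) i),
    setIntegral_weakPartial hU hb.measure_lt_top.ne h2 i⟩

end Velocity

/-! ### Affine changes of variables -/

section Affine

variable {U V : Set Plane} (A : Plane ≃ᵃ[ℝ] Plane)

/-- The factor by which an affine map scales the Lebesgue measure. -/
def measureScale : ENNReal := ENNReal.ofReal |(LinearMap.det (A.linear : Plane →ₗ[ℝ] Plane))⁻¹|

theorem measureScale_ne_top : measureScale A ≠ ⊤ := ENNReal.ofReal_ne_top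

theorem measureScale_pos : 0 < measureScale A :=
  ENNReal.ofReal_pos.2 (abs_pos.2 (inv_ne_zero (LinearEquiv.isUnit_det' A.linear).ne_zero))

/-- An affine equivalence of the plane as a homeomorphism. -/
def affineHomeo : Plane ≃ₜ Plane :=
  (AffineEquiv.toContinuousAffineEquiv A).toHomeomorph

@[simp] theorem coe_affineHomeo : ⇑(affineHomeo A) = A := rfl

theorem affine_apply (x : Plane) : A x = A.linear x + A 0 := by
  have := A.map_vadd 0 x
  simpa using this

theorem map_volume : Measure.map A volume = measureScale A • (volume : Measure Plane) := by
  have h : (A : Plane → Plane) = (fun x => x + A 0) ∘ (A.linear : Plane →ₗ[ℝ] Plane) := by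
    ext1 x
    exact affine_apply A x
  rw [h, ← Measure.map_map (by fun_prop)
      (LinearMap.continuous_of_finiteDimensional _).measurable,
    Measure.map_linearMap_addHaar_eq_smul_addHaar _ (LinearEquiv.isUnit_det' A.linear).ne_zero,
    Measure.map_smul, map_add_right_eq_self]
  rfl

theorem map_restrict_volume (h : U = A ⁻¹' V) :
    Measure.map A (volume.restrict U) = measureScale A • volume.restrict V := by
  have := (affineHomeo A).measurableEmbedding.restrict_map volume V
  rw [coe_affineHomeo] at this
  rw [h, ← this, map_volume, Measure.restrict_smul]

theorem quasiMeasurePreserving_affine (h : U = A ⁻¹' V) :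
    Measure.QuasiMeasurePreserving A (volume.restrict U) (volume.restrict V) where
  measurable := (affineHomeo A).continuous.measurable
  absolutelyContinuous := by
    rw [map_restrict_volume A h]
    exact Measure.smul_absolutelyContinuous

theorem eLpNorm_comp_affine (h : U = A ⁻¹' V) (q : L2 V) :
    eLpNorm (q ∘ A) 2 (volume.restrict U) =
      measureScale A ^ (1 / 2 : ℝ) * eLpNorm q 2 (volume.restrict V) := by
  have hq : AEStronglyMeasurable q (Measure.map A (volume.restrict U)) := by
    rw [map_restrict_volume A h]
    exact (Lp.aestronglyMeasurable q).smul_measure _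
  rw [← eLpNorm_map_measure hq (affineHomeo A).continuous.aemeasurable, map_restrict_volume A h,
    eLpNorm_smul_measure_of_ne_top (by norm_num)]
  simp

theorem memLp_comp_affine (h : U = A ⁻¹' V) (q : L2 V) : MemLp (q ∘ A) 2 (volume.restrict U) := by
  refine ⟨(Lp.aestronglyMeasurable q).comp_quasiMeasurePreserving
    (quasiMeasurePreserving_affine A h), ?_⟩
  rw [eLpNorm_comp_affine A h]
  exact ENNReal.mul_lt_top (ENNReal.rpow_lt_top_of_nonneg (by norm_num) (measureScale_ne_top A))
    (Lp.eLpNorm_lt_top q)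

/-- The factor by which composition with an affine map scales the `L²` norm. -/
def normScale : ℝ := (measureScale A ^ (1 / 2 : ℝ)).toReal

theorem normScale_pos : 0 < normScale A :=
  ENNReal.toReal_pos (ENNReal.rpow_pos (measureScale_pos A) (measureScale_ne_top A)).ne'
    (ENNReal.rpow_lt_top_of_nonneg (by norm_num) (measureScale_ne_top A)).ne

/-- Composition with an affine map `A`, as a linear map `L²(V) → L²(U)` where `U = A⁻¹(V)`. -/
def pullₗ (h : U = A ⁻¹' V) : L2 V →ₗ[ℝ] L2 U where
  toFun q := (memLp_comp_affine A h q).toLp _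
  map_add' q r := by
    rw [← MemLp.toLp_add, MemLp.toLp_eq_toLp_iff]
    exact (quasiMeasurePreserving_affine A h).ae_eq_comp (Lp.coeFn_add q r)
  map_smul' c q := by
    rw [RingHom.id_apply, ← MemLp.toLp_const_smul, MemLp.toLp_eq_toLp_iff]
    exact (quasiMeasurePreserving_affine A h).ae_eq_comp (Lp.coeFn_smul c q)

theorem norm_pullₗ (h : U = A ⁻¹' V) (q : L2 V) : ‖pullₗ A h q‖ = normScale A * ‖q‖ := by
  change ‖(memLp_comp_affine A h q).toLp _‖ = _
  rw [Lp.norm_toLp, eLpNorm_comp_affine A h, ENNReal.toReal_mul, Lp.norm_def, normScale]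

/-- Composition with an affine map as a continuous linear map. -/
def pull (h : U = A ⁻¹' V) : L2 V →L[ℝ] L2 U :=
  (pullₗ A h).mkContinuous (normScale A) fun q => (norm_pullₗ A h q).le

theorem norm_pull (h : U = A ⁻¹' V) (q : L2 V) : ‖pull A h q‖ = normScale A * ‖q‖ :=
  norm_pullₗ A h q

theorem coeFn_pull (h : U = A ⁻¹' V) (q : L2 V) : pull A h q =ᵐ[volume.restrict U] q ∘ A :=
  (memLp_comp_affine A h q).coeFn_toLp

theorem pull_injective (h : U = A ⁻¹' V) : Function.Injective (pull A h) := by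
  rw [injective_iff_map_eq_zero]
  intro q hq
  have := norm_pull A h q
  rw [hq, norm_zero, eq_comm, mul_eq_zero] at this
  exact norm_eq_zero.1 (this.resolve_left (normScale_pos A).ne')

theorem pull_pull_symm (h : U = A ⁻¹' V) (h' : V = A.symm ⁻¹' U) (q : L2 U) :
    pull A h (pull A.symm h' q) = q := by
  refine Lp.ext ?_
  filter_upwards [coeFn_pull A h (pull A.symm h' q),
    (quasiMeasurePreserving_affine A h).ae (coeFn_pull A.symm h' q)] with x h1 h2
  rw [h1, Function.comp_apply, h2, Function.comp_apply, A.symm_apply_apply]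

theorem pull_symm_pull (h : U = A ⁻¹' V) (h' : V = A.symm ⁻¹' U) (q : L2 V) :
    pull A.symm h' (pull A h q) = q :=
  pull_injective A h (pull_pull_symm A h h' _)

theorem setIntegral_pull (h : U = A ⁻¹' V) (q : L2 V) :
    ∫ x in U, pull A h q x = (measureScale A).toReal * ∫ x in V, q x := by
  rw [integral_congr_ae (coeFn_pull A h q)]
  have := (affineHomeo A).measurableEmbedding.integral_map (μ := volume.restrict U) q
  rw [coe_affineHomeo, map_restrict_volume A h, integral_smul_measure] at this
  exact this.symm

theorem pull_mem_L2Zero (h : U = A ⁻¹' V) {q : L2 V} (hq : q ∈ L2Zero V) :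
    pull A h q ∈ L2Zero U := by
  rw [L2Zero, Set.mem_ofPred_eq] at hq ⊢
  rw [setIntegral_pull, hq, mul_zero]

/-- Composition of a polynomial with an affine map is a polynomial of no larger degree. -/
theorem exists_polyFun_comp_affine (P : MvPolynomial (Fin 2) ℝ) :
    ∃ Q : MvPolynomial (Fin 2) ℝ, Q.totalDegree ≤ P.totalDegree ∧
      ∀ x, polyFun Q x = polyFun P (A x) := by
  let g : Fin 2 → MvPolynomial (Fin 2) ℝ := fun i =>
    ∑ k, MvPolynomial.C (A.linear (EuclideanSpace.single k 1) i) * MvPolynomial.X k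
      + MvPolynomial.C (A 0 i)
  have hg : ∀ i, (g i).totalDegree ≤ 1 := fun i => by
    refine (MvPolynomial.totalDegree_add _ _).trans (max_le ?_ (by simp))
    refine MvPolynomial.totalDegree_finsetSum_le fun k _ => ?_
    refine (MvPolynomial.totalDegree_mul _ _).trans (by simp)
  have hgx : ∀ i x, polyFun (g i) x = A x i := fun i x => by
    have h2 : x = ∑ k, x k • EuclideanSpace.single k (1 : ℝ) := by
      ext j; fin_cases j <;> simp
    rw [affine_apply A x]
    conv_rhs => rw [h2, map_sum]
    simp [g, polyFun, mul_comm]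
  refine ⟨MvPolynomial.aeval g P, ?_, fun x => ?_⟩
  · conv_lhs => rw [P.as_sum, map_sum]
    refine MvPolynomial.totalDegree_finsetSum_le fun s hs => ?_
    rw [MvPolynomial.aeval_monomial, MvPolynomial.algebraMap_eq]
    refine (MvPolynomial.totalDegree_mul _ _).trans ?_
    rw [MvPolynomial.totalDegree_C, zero_add]
    refine (MvPolynomial.totalDegree_finsetProd _ _).trans
      (le_trans ?_ (MvPolynomial.le_totalDegree hs))
    refine Finset.sum_le_sum fun i _ => (MvPolynomial.totalDegree_pow _ _).trans ?_
    simpa using Nat.mul_le_mul_left (s i) (hg i)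
  · induction P using MvPolynomial.induction_on with
    | C a => simp [polyFun]
    | add p q hp hq =>
      rw [map_add, polyFun_add, polyFun_add]
      simp only [hp, hq]
    | mul_X p i hp =>
      rw [map_mul, MvPolynomial.aeval_X, polyFun_mul, polyFun_mul, polyFun_X]
      simp only [hp, hgx]

theorem pull_mem_piecewisePoly (h : U = A ⁻¹' V) {𝒯 𝒯' : Set (Set Plane)}
    (h𝒯 : ∀ T' ∈ 𝒯', ∃ T ∈ 𝒯, Set.MapsTo A T' T) {n : ℕ} {v : L2 V}
    (hv : v ∈ piecewisePoly V 𝒯 n) : pull A h v ∈ piecewisePoly U 𝒯' n := by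
  intro T' hT'
  obtain ⟨T, hT, hTT⟩ := h𝒯 T' hT'
  obtain ⟨P, hP, hvP⟩ := mem_piecewisePoly.1 hv T hT
  obtain ⟨Q, hQ, hQP⟩ := exists_polyFun_comp_affine A P
  refine ⟨Q, hQ.trans hP, ?_⟩
  filter_upwards [coeFn_pull A h v, (quasiMeasurePreserving_affine A h).ae hvP] with x h1 h2 hx
  rw [h1, Function.comp_apply, h2 (hTT hx), ← hQP]
  rfl

theorem IsTestFunction.comp_affine (h : U = A ⁻¹' V) {φ : Plane → ℝ} (hφ : IsTestFunction V φ) :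
    IsTestFunction U (φ ∘ A) where
  smooth := hφ.smooth.comp
    (AffineEquiv.toContinuousAffineEquiv A).toContinuousAffineMap.contDiff
  compact := hφ.compact.comp_homeomorph (affineHomeo A)
  support := by
    have := tsupport_comp_eq_preimage φ (affineHomeo A)
    rw [coe_affineHomeo] at this
    rw [this, h]
    exact Set.preimage_mono hφ.support

theorem pderiv_comp_affine {φ : Plane → ℝ} (hφ : Differentiable ℝ φ) (i : Fin 2) (x : Plane) :
    pderiv i (φ ∘ A) x =
      ∑ k, A.linear (EuclideanSpace.single i 1) k * pderiv k φ (A x) := by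
  let L : Plane →L[ℝ] Plane := LinearMap.toContinuousLinearMap (A.linear : Plane →ₗ[ℝ] Plane)
  have hA : HasFDerivAt A L x := by
    have h : (A : Plane → Plane) = fun x => L x + A 0 := by
      ext1 x
      exact affine_apply A x
    rw [h]
    exact L.hasFDerivAt.add_const _
  have h1 := ((hφ (A x)).hasFDerivAt.comp x hA).fderiv
  have h2 : L (EuclideanSpace.single i 1) =
      ∑ k, L (EuclideanSpace.single i 1) k • EuclideanSpace.single k (1 : ℝ) := by
    ext j; fin_cases j <;> simp
  rw [pderiv, h1, ContinuousLinearMap.comp_apply, h2, map_sum]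
  simp [pderiv]
  rfl

/-- The chain rule for weak derivatives on `H¹₀`. -/
theorem pull_mem_sobolevGraph (h : U = A ⁻¹' V) {x : L2 V × (Fin 2 → L2 V)}
    (hx : x ∈ sobolevGraph V) :
    ((pull A h x.1, fun i => ∑ k, A.linear (EuclideanSpace.single i 1) k • pull A h (x.2 k)) :
      L2 U × (Fin 2 → L2 U)) ∈ sobolevGraph U := by
  refine sobolevGraph_induction (P := fun x => ((pull A h x.1,
    fun i => ∑ k, A.linear (EuclideanSpace.single i 1) k • pull A h (x.2 k)) :
      L2 U × (Fin 2 → L2 U)) ∈ sobolevGraph U) ?_ ?_ hx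
  · exact (Submodule.isClosed_topologicalClosure _).preimage (by fun_prop)
  · intro φ hφ
    have aux : ∀ {p : Plane → ℝ} (hp : IsTestFunction V p),
        pull A h (hp.memLp.toLp p) =ᵐ[volume.restrict U] p ∘ A := fun {p} hp =>
      (coeFn_pull A h _).trans
        ((quasiMeasurePreserving_affine A h).ae_eq_comp hp.memLp.coeFn_toLp)
    refine subset_closure ⟨φ ∘ A, hφ.comp_affine A h, aux hφ, fun i => ?_⟩
    dsimp only
    rw [Fin.sum_univ_two]
    filter_upwards [aux (hφ.pderiv 0), aux (hφ.pderiv 1),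
      Lp.coeFn_add (A.linear (EuclideanSpace.single i 1) 0 •
          pull A h ((hφ.pderiv 0).memLp.toLp _))
        (A.linear (EuclideanSpace.single i 1) 1 • pull A h ((hφ.pderiv 1).memLp.toLp _)),
      Lp.coeFn_smul (A.linear (EuclideanSpace.single i 1) 0)
          (pull A h ((hφ.pderiv 0).memLp.toLp _)),
      Lp.coeFn_smul (A.linear (EuclideanSpace.single i 1) 1)
          (pull A h ((hφ.pderiv 1).memLp.toLp _))] with x h0 h1 h2 h3 h4
    rw [h2, Pi.add_apply, h3, h4, Pi.smul_apply, Pi.smul_apply, h0, h1,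
      pderiv_comp_affine A (hφ.smooth.differentiable (by simp)), Fin.sum_univ_two]
    rfl

theorem pull_mem_H10 (h : U = A ⁻¹' V) (hU : IsOpen U) (hV : IsOpen V) {v : L2 V}
    (hv : v ∈ H10 V) : pull A h v ∈ H10 U :=
  mem_H10_of_mem_sobolevGraph hU (pull_mem_sobolevGraph A h ((mem_H10_iff hV).1 hv))

theorem weakPartial_pull (h : U = A ⁻¹' V) (hU : IsOpen U) (hV : IsOpen V) {v : L2 V}
    (hv : v ∈ H10 V) (i : Fin 2) : weakPartial U i (pull A h v) =
      ∑ k, A.linear (EuclideanSpace.single i 1) k • pull A h (weakPartial V k v) :=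
  weakPartial_of_mem_sobolevGraph hU (pull_mem_sobolevGraph A h ((mem_H10_iff hV).1 hv)) i

end Affine

/-! ### Piecewise polynomials in barycentric coordinates -/

section Algebra

open MvPolynomial

/-- The barycentric coordinates of the reference triangle as polynomials. -/
def baryPoly : Fin 3 → MvPolynomial (Fin 2) ℝ := ![1 - X 0 - X 1, X 0, X 1]

/-- The vertices of the reference triangle. -/
def refVertex : Fin 3 → Plane := ![0, EuclideanSpace.single 0 1, EuclideanSpace.single 1 1]

/-- The directional derivative of a polynomial along the edge from vertex `m` to vertex `i`. -/
def edgeDeriv (i m : Fin 3) (P : MvPolynomial (Fin 2) ℝ) : MvPolynomial (Fin 2) ℝ :=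
  ∑ k, C ((refVertex i - refVertex m) k) * MvPolynomial.pderiv k P

theorem edgeDeriv_mul (i m : Fin 3) (P Q : MvPolynomial (Fin 2) ℝ) :
    edgeDeriv i m (P * Q) = P * edgeDeriv i m Q + edgeDeriv i m P * Q := by
  simp only [edgeDeriv, Fin.sum_univ_two, MvPolynomial.pderiv_mul]
  ring

theorem edgeDeriv_pow (i m : Fin 3) (P : MvPolynomial (Fin 2) ℝ) (j : ℕ) :
    edgeDeriv i m (P ^ (j + 1)) = C ((j : ℝ) + 1) * (P ^ j * edgeDeriv i m P) := by
  simp only [edgeDeriv, Fin.sum_univ_two, MvPolynomial.pderiv_pow]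
  simp
  ring

theorem edgeDeriv_baryPoly (i m r : Fin 3) :
    edgeDeriv i m (baryPoly r) = (if r = i then 1 else 0) - (if r = m then 1 else 0) := by
  fin_cases i <;> fin_cases m <;> fin_cases r <;>
    simp [edgeDeriv, baryPoly, refVertex, MvPolynomial.pderiv_X]

theorem totalDegree_baryPoly_le (i : Fin 3) : (baryPoly i).totalDegree ≤ 1 := by
  fin_cases i
  · refine (totalDegree_sub _ _).trans (max_le ((totalDegree_sub _ _).trans ?_) ?_) <;> simp
  · simp [baryPoly]
  · simp [baryPoly]

theorem totalDegree_edgeDeriv_le (i m : Fin 3) (P : MvPolynomial (Fin 2) ℝ) :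
    (edgeDeriv i m P).totalDegree ≤ P.totalDegree - 1 := by
  refine totalDegree_finsetSum_le fun k _ => (totalDegree_mul _ _).trans ?_
  rw [totalDegree_C, zero_add]
  exact totalDegree_pderiv_le k P

theorem sum_baryPoly : ∑ i, baryPoly i = 1 := by
  simp [Fin.sum_univ_three, baryPoly]
  ring

/-- A property of polynomials that is stable under sums and holds for the multiples of the
barycentric coordinates by polynomials of degree at most `k` holds for all polynomials of degree at
most `k + 1`: constants are covered because the barycentric coordinates sum to one. -/
theorem forall_totalDegree_le_succ {k : ℕ} {p : MvPolynomial (Fin 2) ℝ → Prop} (h0 : p 0)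
    (hadd : ∀ P Q, p P → p Q → p (P + Q))
    (hmul : ∀ m g, g.totalDegree ≤ k → p (baryPoly m * g)) (h : MvPolynomial (Fin 2) ℝ)
    (hh : h.totalDegree ≤ k + 1) : p h := by
  rw [h.as_sum]
  refine Finset.sum_induction _ p hadd h0 fun s hs => ?_
  have hs' := (le_totalDegree hs).trans hh
  rw [Finsupp.sum_fintype _ _ (by simp), Fin.sum_univ_two] at hs'
  have key : ∀ i : Fin 2, s i ≠ 0 → p (monomial s (coeff s h)) := fun i hi => by
    have e : monomial s (coeff s h)
        = baryPoly i.succ * monomial (s - Finsupp.single i 1) (coeff s h) := by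
      have : baryPoly i.succ = X i := by fin_cases i <;> rfl
      rw [this, X, monomial_mul, one_mul, add_tsub_cancel_of_le]
      rwa [Finsupp.single_le_iff, Nat.one_le_iff_ne_zero]
    rw [e]
    refine hmul _ _ ((totalDegree_monomial_le _ _).trans ?_)
    rw [Finsupp.sum_fintype _ _ (by simp), Fin.sum_univ_two]
    fin_cases i <;> simp at hi ⊢ <;> omega
  by_cases h1 : s 0 = 0
  · by_cases h2 : s 1 = 0
    · have e : s = 0 := by ext i; fin_cases i <;> simp [h1, h2]
      rw [e, ← C_apply, ← one_mul (C _), ← sum_baryPoly, Finset.sum_mul]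
      exact Finset.sum_induction _ p hadd h0 fun i _ => hmul _ _ (by simp)
    · exact key 1 h2
  · exact key 0 h1

/-- A tuple of polynomials stands for the piecewise polynomial that is its `i`-th entry where the
`i`-th barycentric coordinate `λ i` is the smallest, so that the tuple of the `λ i` stands for
`μ = min λ i`. Modulo derivatives of `μ ^ (j + 1) f` along edges and one fixed element, every
piecewise polynomial of degree at most `n` vanishes: each such derivative allows a remainder
divisible by `μ ^ j` to be traded for one divisible by `μ ^ (j + 1)`. -/
theorem single_mem_of_edgeDeriv_mem {n : ℕ} {J : Submodule ℝ (Fin 3 → MvPolynomial (Fin 2) ℝ)}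
    (hD : ∀ i m j f, j + f.totalDegree ≤ n →
      (fun r => edgeDeriv i m (baryPoly r ^ (j + 1) * f)) ∈ J)
    (h0 : Pi.single 0 (baryPoly 0 ^ n) ∈ J) :
    ∀ (k j : ℕ), j + k = n → ∀ i h, h.totalDegree ≤ k → Pi.single i (baryPoly i ^ j * h) ∈ J := by
  have hC : ∀ i (a : ℝ) (P : MvPolynomial (Fin 2) ℝ),
      (Pi.single i (C a * P) : Fin 3 → MvPolynomial (Fin 2) ℝ) = a • Pi.single i P := by
    intro i a P
    rw [← Pi.single_smul, smul_eq_C_mul]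
  intro k
  induction k with
  | zero =>
    intro j hj i h hh
    obtain rfl : j = n := by omega
    rw [totalDegree_eq_zero_iff_eq_C.1 (Nat.le_zero.1 hh), mul_comm, hC]
    refine J.smul_mem _ ?_
    by_cases hi : i = 0
    · rw [hi]; exact h0
    have h1 := hD i 0 j 1 (by simp)
    have e : (fun r => edgeDeriv i 0 (baryPoly r ^ (j + 1) * 1)) =
        ((j : ℝ) + 1) • (Pi.single i (baryPoly i ^ j) - Pi.single 0 (baryPoly 0 ^ j)) := by
      funext r
      rw [mul_one, edgeDeriv_pow, edgeDeriv_baryPoly, Pi.smul_apply, Pi.sub_apply, smul_eq_C_mul]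
      by_cases h1 : r = i
      · subst h1; simp [hi]
      · by_cases h2 : r = 0
        · subst h2; simp [Ne.symm hi]
        · simp [h1, h2]
    rw [e] at h1
    have h2 := J.smul_mem ((j : ℝ) + 1)⁻¹ h1
    rw [smul_smul, inv_mul_cancel₀ (by positivity), one_smul] at h2
    have := J.add_mem h2 h0
    rwa [sub_add_cancel] at this
  | succ k ih =>
    intro j hj i
    refine forall_totalDegree_le_succ (by simp) (fun P Q hP hQ => ?_) fun m g hg => ?_
    · rw [mul_add, Pi.single_add]
      exact J.add_mem hP hQ
    have hraise : ∀ r f, f.totalDegree ≤ k →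
        (Pi.single r (baryPoly r ^ (j + 1) * f) : Fin 3 → MvPolynomial (Fin 2) ℝ) ∈ J :=
      fun r f hf => ih (j + 1) (by omega) r f hf
    by_cases him : m = i
    · subst him
      rw [← mul_assoc, ← pow_succ]
      exact hraise _ g hg
    -- differentiate `μ ^ (j + 1) λ m g` along the edge from `m` to `i`
    set f := baryPoly m * g with hf
    have hfdeg : f.totalDegree ≤ k + 1 :=
      (totalDegree_mul _ _).trans (by have := totalDegree_baryPoly_le m; omega)
    have h1 := hD i m j f (by omega)
    have hf' : (edgeDeriv i m f).totalDegree ≤ k :=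
      (totalDegree_edgeDeriv_le _ _ _).trans (by omega)
    have e : (fun r => edgeDeriv i m (baryPoly r ^ (j + 1) * f)) =
        ((j : ℝ) + 1) • (Pi.single i (baryPoly i ^ j * f) : Fin 3 → MvPolynomial (Fin 2) ℝ)
          - ((j : ℝ) + 1) •
              (Pi.single m (baryPoly m ^ (j + 1) * g) : Fin 3 → MvPolynomial (Fin 2) ℝ)
          + ∑ r, (Pi.single r (baryPoly r ^ (j + 1) * edgeDeriv i m f) :
              Fin 3 → MvPolynomial (Fin 2) ℝ) := by
      funext r
      rw [edgeDeriv_mul, edgeDeriv_pow, edgeDeriv_baryPoly, Pi.add_apply, Pi.sub_apply,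
        Finset.univ_sum_single, Pi.smul_apply, Pi.smul_apply, smul_eq_C_mul, smul_eq_C_mul]
      by_cases c1 : r = i
      · subst c1; simp [Ne.symm him]; ring
      · by_cases c2 : r = m
        · subst c2; simp [c1, hf]; ring
        · simp [c1, c2]
    rw [e] at h1
    have h2 : ((j : ℝ) + 1) • Pi.single i (baryPoly i ^ j * f) ∈ J := by
      have h3 := J.sub_mem h1 (J.sum_mem fun r (_ : r ∈ Finset.univ) => hraise r _ hf')
      rw [add_sub_cancel_right] at h3
      have h4 := J.add_mem h3 (J.smul_mem ((j : ℝ) + 1) (hraise m g hg))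
      rwa [sub_add_cancel] at h4
    have h3 := J.smul_mem ((j : ℝ) + 1)⁻¹ h2
    rwa [smul_smul, inv_mul_cancel₀ (by positivity), one_smul] at h3

end Algebra

/-! ### Smooth approximation of the minimum of two numbers -/

section SoftMin

open Filter Topology

/-- A smooth approximation from below of `min a b`. -/
def softMin (ε a b : ℝ) : ℝ := (a + b - √((a - b) ^ 2 + ε ^ 2)) / 2

/-- The derivative of `softMin ε` in its first variable at `(a, b)`, as a function of `a - b`. -/
def softWeight (ε t : ℝ) : ℝ := (1 - t / √(t ^ 2 + ε ^ 2)) / 2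

theorem softMin_le_left (ε a b : ℝ) : softMin ε a b ≤ a := by
  have := Real.abs_le_sqrt (x := b - a) (y := (a - b) ^ 2 + ε ^ 2) (by nlinarith [sq_nonneg ε])
  have := le_abs_self (b - a)
  rw [softMin]; linarith

theorem softMin_le_right (ε a b : ℝ) : softMin ε a b ≤ b := by
  have := Real.abs_le_sqrt (x := a - b) (y := (a - b) ^ 2 + ε ^ 2) (by nlinarith [sq_nonneg ε])
  have := le_abs_self (a - b)
  rw [softMin]; linarith

theorem softWeight_nonneg (ε t : ℝ) : 0 ≤ softWeight ε t := by
  have h := Real.abs_le_sqrt (x := t) (y := t ^ 2 + ε ^ 2) (by nlinarith [sq_nonneg ε])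
  have := div_le_one_of_le₀ ((le_abs_self t).trans h) (Real.sqrt_nonneg _)
  rw [softWeight]; linarith

theorem softWeight_le_one (ε t : ℝ) : softWeight ε t ≤ 1 := by
  have h := Real.abs_le_sqrt (x := t) (y := t ^ 2 + ε ^ 2) (by nlinarith [sq_nonneg ε])
  have := div_le_one_of_le₀ ((neg_le_abs t).trans h) (Real.sqrt_nonneg _)
  rw [neg_div] at this
  rw [softWeight]; linarith

variable {ι : Type*} {l : Filter ι} {ε a b t : ι → ℝ} {a₀ b₀ t₀ : ℝ}

theorem tendsto_softMin (hε : Tendsto ε l (𝓝 0)) (ha : Tendsto a l (𝓝 a₀))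
    (hb : Tendsto b l (𝓝 b₀)) :
    Tendsto (fun n => softMin (ε n) (a n) (b n)) l (𝓝 (min a₀ b₀)) := by
  have h := ((ha.add hb).sub (((ha.sub hb).pow 2).add (hε.pow 2)).sqrt).div_const 2
  have e : (a₀ + b₀ - √((a₀ - b₀) ^ 2 + 0 ^ 2)) / 2 = min a₀ b₀ := by
    rw [zero_pow two_ne_zero, add_zero, Real.sqrt_sq_eq_abs]
    rcases le_total a₀ b₀ with hab | hab
    · rw [min_eq_left hab, abs_of_nonpos (by linarith)]; ring
    · rw [min_eq_right hab, abs_of_nonneg (by linarith)]; ring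
  rwa [e] at h

theorem tendsto_softWeight (hε : Tendsto ε l (𝓝 0)) (ht : Tendsto t l (𝓝 t₀)) (h0 : t₀ ≠ 0) :
    Tendsto (fun n => softWeight (ε n) (t n)) l (𝓝 ((1 - t₀ / |t₀|) / 2)) := by
  have h := ((ht.div ((ht.pow 2).add (hε.pow 2)).sqrt (by
    rw [zero_pow two_ne_zero, add_zero, Real.sqrt_sq_eq_abs]; exact abs_ne_zero.2 h0)).const_sub
      1).div_const 2
  rwa [zero_pow two_ne_zero, add_zero, Real.sqrt_sq_eq_abs] at h

theorem tendsto_softWeight_one (hε : Tendsto ε l (𝓝 0)) (ht : Tendsto t l (𝓝 t₀)) (h0 : t₀ < 0) :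
    Tendsto (fun n => softWeight (ε n) (t n)) l (𝓝 1) := by
  have h := tendsto_softWeight hε ht h0.ne
  rwa [abs_of_neg h0, div_neg, div_self h0.ne, show ((1 : ℝ) - -1) / 2 = 1 by norm_num] at h

theorem tendsto_softWeight_zero (hε : Tendsto ε l (𝓝 0)) (ht : Tendsto t l (𝓝 t₀)) (h0 : 0 < t₀) :
    Tendsto (fun n => softWeight (ε n) (t n)) l (𝓝 0) := by
  have h := tendsto_softWeight hε ht h0.ne'
  rwa [abs_of_pos h0, div_self h0.ne', sub_self, zero_div] at h

variable {f g : Plane → ℝ}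

theorem contDiff_softMin {ε : ℝ} (hε : ε ≠ 0) (hf : ContDiff ℝ ∞ f) (hg : ContDiff ℝ ∞ g) :
    ContDiff ℝ ∞ fun x => softMin ε (f x) (g x) := by
  refine ((hf.add hg).sub (ContDiff.sqrt (((hf.sub hg).pow 2).add contDiff_const) ?_)).div_const 2
  intro x
  positivity

theorem pderiv_softMin {ε : ℝ} (hε : ε ≠ 0) (hf : Differentiable ℝ f) (hg : Differentiable ℝ g)
    (i : Fin 2) (x : Plane) : pderiv i (fun x => softMin ε (f x) (g x)) x =
      softWeight ε (f x - g x) * pderiv i f x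
        + (1 - softWeight ε (f x - g x)) * pderiv i g x := by
  have hpos : 0 < (f x - g x) ^ 2 + ε ^ 2 := by positivity
  have h1 := (hf x).hasFDerivAt
  have h2 := (hg x).hasFDerivAt
  have h3 : HasFDerivAt (fun x => softMin ε (f x) (g x)) _ x :=
    ((h1.add h2).sub ((((h1.sub h2).pow 2).add_const (ε ^ 2)).sqrt hpos.ne')).mul_const (2 : ℝ)⁻¹
  rw [pderiv, h3.fderiv]
  have := (Real.sqrt_pos.2 hpos).ne'
  simp [softWeight, pderiv]
  field_simp
  ring

end SoftMin

/-! ### A smooth cut-off of the positive part -/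

section Cutoff

open Filter Topology

/-- A smooth function that vanishes for `t ≤ 1` and equals `t` for `2 ≤ t`. -/
def cutoff (t : ℝ) : ℝ := t * Real.smoothTransition (t - 1)

theorem contDiff_cutoff : ContDiff ℝ ∞ cutoff :=
  contDiff_id.mul (Real.smoothTransition.contDiff.comp (contDiff_id.sub contDiff_const))

theorem cutoff_of_le {t : ℝ} (ht : t ≤ 1) : cutoff t = 0 := by
  rw [cutoff, Real.smoothTransition.zero_of_nonpos (by linarith), mul_zero]

theorem cutoff_of_ge {t : ℝ} (ht : 2 ≤ t) : cutoff t = t := by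
  rw [cutoff, Real.smoothTransition.one_of_one_le (by linarith), mul_one]

theorem cutoff_nonneg (t : ℝ) : 0 ≤ cutoff t := by
  rcases le_total t 1 with h | h
  · rw [cutoff_of_le h]
  · exact mul_nonneg (by linarith) (Real.smoothTransition.nonneg _)

theorem cutoff_le (t : ℝ) : cutoff t ≤ max t 0 := by
  rcases le_total t 1 with h | h
  · rw [cutoff_of_le h]; exact le_max_right _ _
  · refine le_trans ?_ (le_max_left _ _)
    exact mul_le_of_le_one_right (by linarith) (Real.smoothTransition.le_one _)

theorem deriv_cutoff_of_gt {t : ℝ} (ht : 2 < t) : deriv cutoff t = 1 := by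
  have : cutoff =ᶠ[𝓝 t] id := by
    filter_upwards [lt_mem_nhds ht] with s hs
    exact cutoff_of_ge hs.le
  rw [this.deriv_eq, deriv_id]

theorem deriv_cutoff_of_lt {t : ℝ} (ht : t < 1) : deriv cutoff t = 0 := by
  have : cutoff =ᶠ[𝓝 t] fun _ => 0 := by
    filter_upwards [gt_mem_nhds ht] with s hs
    exact cutoff_of_le hs.le
  rw [this.deriv_eq, deriv_const]

theorem exists_abs_deriv_cutoff_le : ∃ B, ∀ t, |deriv cutoff t| ≤ B := by
  obtain ⟨B, hB⟩ := (isCompact_Icc (a := (1 : ℝ)) (b := 2)).exists_bound_of_continuousOn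
    (contDiff_cutoff.continuous_deriv (by simp)).continuousOn
  refine ⟨max B 1, fun t => ?_⟩
  rcases lt_or_ge t 1 with h | h
  · rw [deriv_cutoff_of_lt h, abs_zero]; exact zero_le_one.trans (le_max_right _ _)
  rcases lt_or_ge 2 t with h' | h'
  · rw [deriv_cutoff_of_gt h', abs_one]; exact le_max_right _ _
  · exact (hB t ⟨h, h'⟩).trans (le_max_left _ _)

end Cutoff

/-! ### The reference triangle -/

section Reference

open Filter Topology

/-- The barycentric coordinates of the reference triangle. -/
def bary (i : Fin 3) : Plane → ℝ := polyFun (baryPoly i)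

theorem bary_zero (x : Plane) : bary 0 x = 1 - x 0 - x 1 := by simp [bary, baryPoly, polyFun]

theorem bary_one (x : Plane) : bary 1 x = x 0 := by simp [bary, baryPoly]

theorem bary_two (x : Plane) : bary 2 x = x 1 := by simp [bary, baryPoly]

theorem contDiff_bary (i : Fin 3) : ContDiff ℝ ∞ (bary i) := contDiff_polyFun _

theorem sum_bary (x : Plane) : bary 0 x + bary 1 x + bary 2 x = 1 := by
  rw [bary_zero, bary_one, bary_two]; ring

theorem abs_pderiv_bary_le (k : Fin 2) (i : Fin 3) (x : Plane) : |pderiv k (bary i) x| ≤ 1 := by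
  rw [bary, pderiv_polyFun]
  fin_cases i <;> fin_cases k <;> simp [baryPoly, MvPolynomial.pderiv_X, polyFun]

/-- The open reference triangle. -/
def refTri : Set Plane := {x | ∀ i, 0 < bary i x}

/-- The part of the plane in which the `i`-th barycentric coordinate is the smallest one. -/
def refCell (i : Fin 3) : Set Plane := {x | ∀ m, m ≠ i → bary i x < bary m x}

theorem isOpen_refTri : IsOpen refTri := by
  have : refTri = ⋂ i, {x | 0 < bary i x} := by ext; simp [refTri]
  rw [this]
  exact isOpen_iInter_of_finite fun i =>
    isOpen_lt continuous_const (contDiff_bary i).continuous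

theorem isBounded_of_bary_nonneg : Bornology.IsBounded {x | ∀ i, 0 ≤ bary i x} := by
  refine isBounded_iff_forall_norm_le.2 ⟨2, fun x hx => ?_⟩
  have h0 := hx 0
  have h1 := hx 1
  have h2 := hx 2
  rw [bary_zero] at h0
  rw [bary_one] at h1
  rw [bary_two] at h2
  rw [EuclideanSpace.norm_eq, Fin.sum_univ_two, Real.norm_eq_abs, Real.norm_eq_abs, sq_abs, sq_abs,
    Real.sqrt_le_left (by norm_num)]
  nlinarith

theorem isBounded_refTri : Bornology.IsBounded refTri :=
  isBounded_of_bary_nonneg.subset fun _ hx i => (hx i).le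

theorem bary_le_one {x : Plane} (hx : x ∈ refTri) (i : Fin 3) : bary i x ≤ 1 := by
  have h := sum_bary x
  have h0 := hx 0
  have h1 := hx 1
  have h2 := hx 2
  fin_cases i <;> simp <;> linarith

/-- A smooth approximation from below of the smallest barycentric coordinate. -/
def softHat (ε : ℝ) (x : Plane) : ℝ := softMin ε (softMin ε (bary 0 x) (bary 1 x)) (bary 2 x)

theorem softHat_le (ε : ℝ) (i : Fin 3) (x : Plane) : softHat ε x ≤ bary i x := by
  have h := softMin_le_left ε (softMin ε (bary 0 x) (bary 1 x)) (bary 2 x)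
  fin_cases i
  · exact h.trans (softMin_le_left _ _ _)
  · exact h.trans (softMin_le_right _ _ _)
  · exact softMin_le_right _ _ _

theorem contDiff_softHat {ε : ℝ} (hε : ε ≠ 0) : ContDiff ℝ ∞ (softHat ε) :=
  contDiff_softMin hε (contDiff_softMin hε (contDiff_bary 0) (contDiff_bary 1)) (contDiff_bary 2)

theorem abs_convex_combination_le {w a b : ℝ} (h0 : 0 ≤ w) (h1 : w ≤ 1) (ha : |a| ≤ 1)
    (hb : |b| ≤ 1) : |w * a + (1 - w) * b| ≤ 1 := by
  rw [abs_le] at *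
  constructor <;> nlinarith

theorem pderiv_softHat {ε : ℝ} (hε : ε ≠ 0) (k : Fin 2) (x : Plane) :
    pderiv k (softHat ε) x =
      softWeight ε (softMin ε (bary 0 x) (bary 1 x) - bary 2 x) *
        (softWeight ε (bary 0 x - bary 1 x) * pderiv k (bary 0) x
          + (1 - softWeight ε (bary 0 x - bary 1 x)) * pderiv k (bary 1) x)
      + (1 - softWeight ε (softMin ε (bary 0 x) (bary 1 x) - bary 2 x)) * pderiv k (bary 2) x := by
  have hd : ∀ i, Differentiable ℝ (bary i) := fun i => (contDiff_bary i).differentiable (by simp)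
  have h := pderiv_softMin hε ((contDiff_softMin hε (contDiff_bary 0)
    (contDiff_bary 1)).differentiable (by simp)) (hd 2) k x
  rw [pderiv_softMin hε (hd 0) (hd 1)] at h
  exact h

theorem abs_pderiv_softHat_le {ε : ℝ} (hε : ε ≠ 0) (k : Fin 2) (x : Plane) :
    |pderiv k (softHat ε) x| ≤ 1 := by
  rw [pderiv_softHat hε]
  refine abs_convex_combination_le (softWeight_nonneg _ _) (softWeight_le_one _ _) ?_
    (abs_pderiv_bary_le _ _ _)
  exact abs_convex_combination_le (softWeight_nonneg _ _) (softWeight_le_one _ _)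
    (abs_pderiv_bary_le _ _ _) (abs_pderiv_bary_le _ _ _)

variable {ε : ℕ → ℝ} {i : Fin 3} {x : Plane}

theorem tendsto_softHat (hε : Tendsto ε atTop (𝓝 0)) (hx : x ∈ refCell i) :
    Tendsto (fun n => softHat (ε n) x) atTop (𝓝 (bary i x)) := by
  have h := tendsto_softMin hε (tendsto_softMin hε (tendsto_const_nhds (x := bary 0 x))
    (tendsto_const_nhds (x := bary 1 x))) (tendsto_const_nhds (x := bary 2 x))
  suffices e : bary i x = min (min (bary 0 x) (bary 1 x)) (bary 2 x) by rw [e]; exact h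
  have e : ∀ m, bary i x ≤ bary m x := fun m => by
    by_cases hm : m = i
    · rw [hm]
    · exact (hx m hm).le
  refine le_antisymm (le_min (le_min (e 0) (e 1)) (e 2)) ?_
  clear h e hx
  fin_cases i
  · exact (min_le_left _ _).trans (min_le_left _ _)
  · exact (min_le_left _ _).trans (min_le_right _ _)
  · exact min_le_right _ _

theorem tendsto_pderiv_softHat (hε : Tendsto ε atTop (𝓝 0)) (h0 : ∀ n, ε n ≠ 0)
    (hx : x ∈ refCell i) (k : Fin 2) :
    Tendsto (fun n => pderiv k (softHat (ε n)) x) atTop (𝓝 (pderiv k (bary i) x)) := by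
  simp only [fun n => pderiv_softHat (h0 n) k x]
  have hin := tendsto_softMin hε (tendsto_const_nhds (x := bary 0 x))
    (tendsto_const_nhds (x := bary 1 x))
  have hout := hin.sub_const (bary 2 x)
  set w : ℕ → ℝ := fun n => softWeight (ε n) (softMin (ε n) (bary 0 x) (bary 1 x) - bary 2 x)
  have hc : Tendsto (fun _ : ℕ => bary 0 x - bary 1 x) atTop (𝓝 (bary 0 x - bary 1 x)) :=
    tendsto_const_nhds
  fin_cases i
  · have h1 : bary 0 x < bary 1 x := hx 1 (by decide)
    have h2 : bary 0 x < bary 2 x := hx 2 (by decide)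
    have t1 := tendsto_softWeight_one hε hc (by linarith)
    have t2 : Tendsto w atTop (𝓝 1) :=
      tendsto_softWeight_one hε hout (by rw [min_eq_left h1.le]; linarith)
    simpa using (t2.mul ((t1.mul_const (pderiv k (bary 0) x)).add
      ((t1.const_sub 1).mul_const (pderiv k (bary 1) x)))).add
        ((t2.const_sub 1).mul_const (pderiv k (bary 2) x))
  · have h1 : bary 1 x < bary 0 x := hx 0 (by decide)
    have h2 : bary 1 x < bary 2 x := hx 2 (by decide)
    have t1 := tendsto_softWeight_zero hε hc (by linarith)
    have t2 : Tendsto w atTop (𝓝 1) :=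
      tendsto_softWeight_one hε hout (by rw [min_eq_right h1.le]; linarith)
    simpa using (t2.mul ((t1.mul_const (pderiv k (bary 0) x)).add
      ((t1.const_sub 1).mul_const (pderiv k (bary 1) x)))).add
        ((t2.const_sub 1).mul_const (pderiv k (bary 2) x))
  · have h1 : bary 2 x < bary 0 x := hx 0 (by decide)
    have h2 : bary 2 x < bary 1 x := hx 1 (by decide)
    have t2 : Tendsto w atTop (𝓝 0) :=
      tendsto_softWeight_zero hε hout (by linarith [lt_min h1 h2])
    -- the inner weights need not converge where the first two coordinates agree
    have t3 : Tendsto (fun n => w n * (softWeight (ε n) (bary 0 x - bary 1 x) *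
        pderiv k (bary 0) x + (1 - softWeight (ε n) (bary 0 x - bary 1 x)) *
          pderiv k (bary 1) x)) atTop (𝓝 0) := by
      refine squeeze_zero_norm (fun n => ?_) t2
      rw [norm_mul, Real.norm_of_nonneg (softWeight_nonneg _ _)]
      exact mul_le_of_le_one_right (softWeight_nonneg _ _)
        (abs_convex_combination_le (softWeight_nonneg _ _) (softWeight_le_one _ _)
          (abs_pderiv_bary_le _ _ _) (abs_pderiv_bary_le _ _ _))
    simpa using t3.add ((t2.const_sub 1).mul_const (pderiv k (bary 2) x))

/-- A test function on the reference triangle that approximates the smallest barycentric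
coordinate. -/
def refBump (ε : ℝ) (x : Plane) : ℝ := ε * cutoff (softHat ε x / ε)

theorem isTestFunction_refBump {ε : ℝ} (hε : 0 < ε) : IsTestFunction refTri (refBump ε) := by
  have hS : IsClosed {x : Plane | ∀ i, ε ≤ bary i x} := by
    have : {x : Plane | ∀ i, ε ≤ bary i x} = ⋂ i, {x | ε ≤ bary i x} := by ext; simp
    rw [this]
    exact isClosed_iInter fun i => isClosed_le continuous_const (contDiff_bary i).continuous
  have hsub : tsupport (refBump ε) ⊆ {x : Plane | ∀ i, ε ≤ bary i x} := by
    refine closure_minimal (fun x hx i => ?_) hS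
    by_contra! h
    refine hx ?_
    rw [refBump, cutoff_of_le, mul_zero]
    exact (div_le_one hε).2 ((softHat_le ε i x).trans h.le)
  refine ⟨?_, ?_, fun x hx i => hε.trans_le (hsub hx i)⟩
  · exact contDiff_const.mul (contDiff_cutoff.comp ((contDiff_softHat hε.ne').div_const ε))
  · refine IsCompact.of_isClosed_subset (Metric.isCompact_of_isClosed_isBounded hS ?_)
      (isClosed_tsupport _) hsub
    exact isBounded_of_bary_nonneg.subset fun x hx i => hε.le.trans (hx i)

theorem abs_refBump_le {ε : ℝ} (hε : 0 < ε) (hx : x ∈ refTri) : |refBump ε x| ≤ 1 := by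
  rw [refBump, abs_of_nonneg (mul_nonneg hε.le (cutoff_nonneg _))]
  refine (mul_le_mul_of_nonneg_left (cutoff_le _) hε.le).trans ?_
  rw [mul_max_of_nonneg _ _ hε.le, mul_div_cancel₀ _ hε.ne', mul_zero]
  exact max_le ((softHat_le ε 0 x).trans (bary_le_one hx 0)) zero_le_one

theorem pderiv_refBump {ε : ℝ} (hε : 0 < ε) (k : Fin 2) (x : Plane) :
    pderiv k (refBump ε) x = deriv cutoff (softHat ε x / ε) * pderiv k (softHat ε) x := by
  have h1 := ((contDiff_softHat hε.ne').differentiable (by simp) x).hasFDerivAt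
  have h2 := (contDiff_cutoff.differentiable (by simp) (softHat ε x * ε⁻¹)).hasDerivAt
  have h3 := (h2.comp_hasFDerivAt x (h1.mul_const ε⁻¹)).const_mul ε
  have e : refBump ε = fun x => ε * (cutoff ∘ fun y => softHat ε y * ε⁻¹) x := by
    ext; rw [refBump, div_eq_mul_inv]; rfl
  rw [pderiv, e, h3.fderiv]
  simp [pderiv, div_eq_mul_inv]
  field_simp

theorem tendsto_refBump (hε : Tendsto ε atTop (𝓝 0)) (h0 : ∀ n, 0 < ε n) (hx : x ∈ refTri)
    (hx' : x ∈ refCell i) :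
    Tendsto (fun n => refBump (ε n) x) atTop (𝓝 (bary i x)) ∧
      ∀ k, Tendsto (fun n => pderiv k (refBump (ε n)) x) atTop (𝓝 (pderiv k (bary i) x)) := by
  have h1 := tendsto_softHat hε hx'
  have h2 : ∀ᶠ n in atTop, 2 < softHat (ε n) x / ε n := by
    have h3 : Tendsto (fun n => 2 * ε n) atTop (𝓝 0) := by simpa using hε.const_mul 2
    filter_upwards [h3.eventually_lt h1 (hx i)] with n hn
    rwa [lt_div_iff₀ (h0 n)]
  refine ⟨h1.congr' ?_, fun k => (tendsto_pderiv_softHat hε (fun n => (h0 n).ne') hx' k).congr' ?_⟩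
  · filter_upwards [h2] with n hn
    rw [refBump, cutoff_of_ge hn.le, mul_div_cancel₀ _ (h0 n).ne']
  · filter_upwards [h2] with n hn
    rw [pderiv_refBump (h0 n), deriv_cutoff_of_gt hn, one_mul]

end Reference

/-! ### Piecewise polynomials on the reference triangle -/

section Glue

open Filter Topology

/-- The triangles of the barycentric refinement of the reference triangle. -/
def refPiece (i : Fin 3) : Set Plane := {x | 0 ≤ bary i x ∧ ∀ m, bary i x ≤ bary m x}

theorem refCell_subset_refPiece {i : Fin 3} {x : Plane} (hx : x ∈ refTri) (hi : x ∈ refCell i) :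
    x ∈ refPiece i := by
  refine ⟨(hx i).le, fun m => ?_⟩
  by_cases hm : m = i
  · rw [hm]
  · exact (hi m hm).le

theorem eq_of_mem_refPiece {i m : Fin 3} {x : Plane} (hi : x ∈ refPiece i) (hm : x ∈ refCell m) :
    i = m := by
  by_contra h
  exact absurd (hm i h) (not_lt.2 (hi.2 m))

theorem eq_of_mem_refCell {i m : Fin 3} {x : Plane} (hi : x ∈ refCell i) (hm : x ∈ refCell m) :
    i = m := by
  by_contra h
  exact lt_asymm (hm i h) (hi m (Ne.symm h))

theorem isOpen_refCell (i : Fin 3) : IsOpen (refCell i) := by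
  have : refCell i = ⋂ m, ⋂ (_ : m ≠ i), {x | bary i x < bary m x} := by ext; simp [refCell]
  rw [this]
  exact isOpen_iInter_of_finite fun m => isOpen_iInter_of_finite fun _ =>
    isOpen_lt (contDiff_bary i).continuous (contDiff_bary m).continuous

theorem bary_affine (i : Fin 3) (c : ℝ) (x y z : Plane) :
    bary i (c • (x - y) + z) = c * (bary i x - bary i y) + bary i z := by
  fin_cases i
  · simp [bary_zero]; ring
  · simp [bary_one]
  · simp [bary_two]

theorem convex_refPiece (i : Fin 3) : Convex ℝ (refPiece i) := by
  intro x hx y hy a b ha hb hab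
  obtain rfl : b = 1 - a := by linarith
  have hcomb : ∀ m, bary m (a • x + (1 - a) • y) = a * bary m x + (1 - a) * bary m y := fun m => by
    rw [show a • x + (1 - a) • y = a • (x - y) + y by module, bary_affine]
    ring
  refine ⟨?_, fun m => ?_⟩
  · rw [hcomb]; exact add_nonneg (mul_nonneg ha hx.1) (mul_nonneg hb hy.1)
  · rw [hcomb, hcomb]
    exact add_le_add (mul_le_mul_of_nonneg_left (hx.2 m) ha)
      (mul_le_mul_of_nonneg_left (hy.2 m) hb)

theorem bary_refVertex (i m : Fin 3) : bary i (refVertex m) = if i = m then 1 else 0 := by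
  fin_cases i <;> fin_cases m <;> simp [bary_zero, bary_one, bary_two, refVertex]

/-- The line on which two barycentric coordinates agree. -/
def equalLine (i m : Fin 3) : AffineSubspace ℝ Plane where
  carrier := {x | bary i x = bary m x}
  smul_vsub_vadd_mem' := by
    intro c x y z hx hy hz
    rw [Set.mem_ofPred_eq] at *
    rw [vsub_eq_sub, vadd_eq_add, bary_affine, bary_affine, hx, hy, hz]

theorem volume_equalLine {i m : Fin 3} (h : i ≠ m) :
    volume {x | bary i x = bary m x} = 0 := by
  refine Measure.addHaar_affineSubspace volume (equalLine i m) fun h' => ?_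
  have : refVertex i ∈ equalLine i m := by rw [h']; trivial
  have h2 : bary i (refVertex i) = bary m (refVertex i) := this
  rw [bary_refVertex, bary_refVertex, if_pos rfl, if_neg h.symm] at h2
  exact one_ne_zero h2

theorem ae_exists_mem_refCell : ∀ᵐ x ∂(volume : Measure Plane), ∃ i, x ∈ refCell i := by
  have h : ∀ i m : Fin 3, ∀ᵐ x ∂(volume : Measure Plane), i ≠ m → bary i x ≠ bary m x := by
    intro i m
    by_cases him : i = m
    · simp [him]
    · filter_upwards [measure_eq_zero_iff_ae_notMem.1 (volume_equalLine him)] with x hx _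
      exact hx
  filter_upwards [ae_all_iff.2 fun i => ae_all_iff.2 fun m => h i m] with x hx
  obtain ⟨i, hi⟩ := Finite.exists_min fun i => bary i x
  exact ⟨i, fun m hm => lt_of_le_of_ne (hi m) (hx i m hm.symm)⟩

/-- The function that is the polynomial `P i` on `refCell i`. -/
def glue (P : Fin 3 → MvPolynomial (Fin 2) ℝ) (x : Plane) : ℝ :=
  ∑ i, (refCell i).indicator (polyFun (P i)) x

theorem glue_apply (P : Fin 3 → MvPolynomial (Fin 2) ℝ) {i : Fin 3} {x : Plane}
    (hx : x ∈ refCell i) : glue P x = polyFun (P i) x := by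
  rw [glue, Finset.sum_eq_single i, Set.indicator_of_mem hx]
  · intro m _ hm
    exact Set.indicator_of_notMem (fun h => hm (eq_of_mem_refCell h hx)) _
  · simp

theorem memLp_glue (P : Fin 3 → MvPolynomial (Fin 2) ℝ) :
    MemLp (glue P) 2 (volume.restrict refTri) :=
  memLp_finsetSum _ fun i _ =>
    (memLp_of_continuous isBounded_refTri (contDiff_polyFun (P i)).continuous).indicator
      (isOpen_refCell i).measurableSet

/-- `glue` as a linear map to `L²` of the reference triangle. -/
def glueₗ : (Fin 3 → MvPolynomial (Fin 2) ℝ) →ₗ[ℝ] L2 refTri where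
  toFun P := (memLp_glue P).toLp _
  map_add' P Q := by
    rw [← MemLp.toLp_add, MemLp.toLp_eq_toLp_iff]
    filter_upwards [ae_restrict_of_ae ae_exists_mem_refCell] with x ⟨i, hi⟩
    rw [Pi.add_apply, glue_apply _ hi, glue_apply _ hi, glue_apply _ hi, Pi.add_apply, polyFun_add]
  map_smul' c P := by
    rw [RingHom.id_apply, ← MemLp.toLp_const_smul, MemLp.toLp_eq_toLp_iff]
    filter_upwards [ae_restrict_of_ae ae_exists_mem_refCell] with x ⟨i, hi⟩
    rw [Pi.smul_apply, glue_apply _ hi, glue_apply _ hi, Pi.smul_apply, polyFun,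
      MvPolynomial.smul_eval, polyFun, smul_eq_mul]

theorem coeFn_glueₗ (P : Fin 3 → MvPolynomial (Fin 2) ℝ) :
    glueₗ P =ᵐ[volume.restrict refTri] glue P :=
  (memLp_glue P).coeFn_toLp

theorem glueₗ_apply (P : Fin 3 → MvPolynomial (Fin 2) ℝ) :
    ∀ᵐ x ∂(volume.restrict refTri), ∃ i, x ∈ refCell i ∧ glueₗ P x = polyFun (P i) x := by
  filter_upwards [coeFn_glueₗ P, ae_restrict_of_ae ae_exists_mem_refCell] with x hx ⟨i, hi⟩
  exact ⟨i, hi, hx.trans (glue_apply P hi)⟩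

theorem glueₗ_mem_piecewisePoly {n : ℕ} {P : Fin 3 → MvPolynomial (Fin 2) ℝ}
    (hP : ∀ i, (P i).totalDegree ≤ n) : glueₗ P ∈ piecewisePoly refTri (Set.range refPiece) n := by
  rintro _ ⟨i, rfl⟩
  refine ⟨P i, hP i, ?_⟩
  filter_upwards [glueₗ_apply P] with x ⟨m, hm, hx⟩ hi
  rw [hx, eq_of_mem_refPiece hi hm]
  rfl

theorem exists_glueₗ_eq {n : ℕ} {v : L2 refTri}
    (hv : v ∈ piecewisePoly refTri (Set.range refPiece) n) :
    ∃ P : Fin 3 → MvPolynomial (Fin 2) ℝ, (∀ i, (P i).totalDegree ≤ n) ∧ glueₗ P = v := by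
  choose P hP hPv using fun i => mem_piecewisePoly.1 hv (refPiece i) ⟨i, rfl⟩
  refine ⟨P, hP, Lp.ext ?_⟩
  filter_upwards [glueₗ_apply P, ae_all_iff.2 hPv, ae_restrict_mem isOpen_refTri.measurableSet]
    with x ⟨i, hi, hx⟩ h2 h3
  rw [hx, h2 i (refCell_subset_refPiece h3 hi)]

instance finiteDimensional_piecewisePolySub_refTri (n : ℕ) :
    FiniteDimensional ℝ (piecewisePolySub refTri (Set.range refPiece) n) := by
  let f := glueₗ ∘ₗ (MvPolynomial.restrictTotalDegree (Fin 2) ℝ n).subtype.compLeft (Fin 3)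
  have hle : piecewisePolySub refTri (Set.range refPiece) n ≤ LinearMap.range f := by
    intro v hv
    obtain ⟨P, hP, rfl⟩ := exists_glueₗ_eq hv
    exact ⟨fun i => ⟨P i, (MvPolynomial.mem_restrictTotalDegree _ _ _).2 (hP i)⟩, rfl⟩
  exact Submodule.finiteDimensional_of_le hle

instance finiteDimensional_velocity {U : Set Plane} {𝒯 : Set (Set Plane)} {n : ℕ}
    [FiniteDimensional ℝ (piecewisePolySub U 𝒯 n)] : FiniteDimensional ℝ (velocity U 𝒯 n) := by
  let f : velocity U 𝒯 n →ₗ[ℝ] Fin 2 → piecewisePolySub U 𝒯 n :=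
    { toFun := fun u i => ⟨u.1 i, (Submodule.mem_pi.1 u.2 i trivial).1⟩
      map_add' := fun _ _ => rfl
      map_smul' := fun _ _ => rfl }
  refine FiniteDimensional.of_injective f fun u v h => Subtype.ext (funext fun i => ?_)
  exact congrArg Subtype.val (congrFun h i)

instance finiteDimensional_pressureSub {U : Set Plane} (hb : Bornology.IsBounded U)
    {𝒯 : Set (Set Plane)} {n : ℕ} [FiniteDimensional ℝ (piecewisePolySub U 𝒯 n)] :
    FiniteDimensional ℝ (pressureSub hb 𝒯 n) :=
  Submodule.finiteDimensional_of_le (S₂ := piecewisePolySub U 𝒯 n) fun _ h => h.1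

/-! ### Powers of the hat function times polynomials are in `H¹₀` -/

theorem pderiv_mul_pow {f b : Plane → ℝ} (hf : Differentiable ℝ f) (hb : Differentiable ℝ b)
    (j : ℕ) (k : Fin 2) (x : Plane) : pderiv k (fun x => f x * b x ^ (j + 1)) x =
      f x * ((j + 1) * b x ^ j * pderiv k b x) + b x ^ (j + 1) * pderiv k f x := by
  rw [pderiv_mul (ψ := fun x => b x ^ (j + 1)) hf (hb.pow _)]
  congr 2
  have h := ((hb x).hasFDerivAt.pow (j + 1)).fderiv
  rw [pderiv, h]
  simp [pderiv]

/-- Replacing the hat function by the smooth bumps `refBump ε` gives test functions that converge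
almost everywhere, together with their gradients, and stay bounded. -/
theorem glueₗ_pow_mul_mem_sobolevGraph (j : ℕ) (f : MvPolynomial (Fin 2) ℝ) :
    ((glueₗ fun i => baryPoly i ^ (j + 1) * f,
      fun k => glueₗ fun i => MvPolynomial.pderiv k (baryPoly i ^ (j + 1) * f)) :
        L2 refTri × (Fin 2 → L2 refTri)) ∈ sobolevGraph refTri := by
  obtain ⟨B, hB⟩ := exists_abs_deriv_cutoff_le
  have hB0 : 0 ≤ B := (abs_nonneg _).trans (hB 0)
  have hbound : ∀ g : MvPolynomial (Fin 2) ℝ, ∃ F, ∀ x ∈ refTri, |polyFun g x| ≤ F := fun g => by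
    obtain ⟨F, hF⟩ := isBounded_refTri.isCompact_closure.exists_bound_of_continuousOn
      (contDiff_polyFun g).continuous.continuousOn
    exact ⟨F, fun x hx => hF x (subset_closure hx)⟩
  obtain ⟨F, hF⟩ := hbound f
  choose F' hF' using fun k => hbound (MvPolynomial.pderiv k f)
  have hεpos : ∀ n : ℕ, (0 : ℝ) < 1 / ((n : ℝ) + 1) := fun n => by positivity
  have hε : Tendsto (fun n : ℕ => 1 / ((n : ℝ) + 1)) atTop (𝓝 0) :=
    tendsto_one_div_add_atTop_nhds_zero_nat
  set b : ℕ → Plane → ℝ := fun n => refBump (1 / ((n : ℝ) + 1)) with hb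
  have hbt : ∀ n, IsTestFunction refTri (b n) := fun n => isTestFunction_refBump (hεpos n)
  have hb1 : ∀ n, ∀ x ∈ refTri, |b n x| ≤ 1 := fun n x hx => abs_refBump_le (hεpos n) hx
  have hb2 : ∀ n k x, |pderiv k (b n) x| ≤ B := fun n k x => by
    rw [hb, pderiv_refBump (hεpos n), abs_mul]
    have := mul_le_mul (hB (softHat (1 / ((n : ℝ) + 1)) x / (1 / ((n : ℝ) + 1))))
      (abs_pderiv_softHat_le (hεpos n).ne' k x) (abs_nonneg _) hB0
    rwa [mul_one] at this
  have hfd : Differentiable ℝ (polyFun f) := (contDiff_polyFun f).differentiable (by simp)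
  have hbd : ∀ n, Differentiable ℝ (b n) := fun n => (hbt n).smooth.differentiable (by simp)
  have hl : ∀ i, polyFun (baryPoly i ^ (j + 1) * f) =
      fun x => polyFun f x * bary i x ^ (j + 1) := by
    intro i
    ext x
    simp [polyFun, bary, mul_comm]
  have hpow : ∀ n, ∀ x ∈ refTri, ∀ m : ℕ, |b n x ^ m| ≤ 1 := fun n x hx m => by
    rw [abs_pow]; exact pow_le_one₀ (abs_nonneg _) (hb1 n x hx)
  refine mem_sobolevGraph_of_tendsto isBounded_refTri.measure_lt_top.ne
    (φ := fun n x => polyFun f x * b n x ^ (j + 1)) (fun n => ?_)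
    (|F| + |F| * ((j + 1) * B) + ∑ k, |F' k|) (fun n x hx => ?_) (fun n k x hx => ?_) ?_ fun k => ?_
  · have := (hbt n).mul_left ((contDiff_polyFun f).mul ((hbt n).smooth.pow j))
    simpa only [mul_assoc, ← pow_succ] using this
  · rw [abs_mul]
    have h1 : |polyFun f x| * |b n x ^ (j + 1)| ≤ |F| * 1 :=
      mul_le_mul ((hF x hx).trans (le_abs_self F)) (hpow n x hx _) (abs_nonneg _) (abs_nonneg _)
    have h2 : 0 ≤ ∑ k, |F' k| := Finset.sum_nonneg fun k _ => abs_nonneg _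
    have h3 : 0 ≤ |F| * ((j + 1) * B) := by positivity
    linarith
  · rw [pderiv_mul_pow hfd (hbd n), pderiv_polyFun]
    have h1 : |polyFun f x * ((j + 1) * b n x ^ j * pderiv k (b n) x)| ≤ |F| * ((j + 1) * B) := by
      rw [abs_mul, abs_mul, abs_mul]
      refine mul_le_mul ((hF x hx).trans (le_abs_self F)) ?_ (by positivity) (abs_nonneg _)
      refine mul_le_mul ?_ (hb2 n k x) (abs_nonneg _) (by positivity)
      rw [abs_of_nonneg (by positivity)]
      exact mul_le_of_le_one_right (by positivity) (hpow n x hx j)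
    have h2 : |b n x ^ (j + 1) * polyFun (MvPolynomial.pderiv k f) x| ≤ 1 * |F' k| := by
      rw [abs_mul]
      exact mul_le_mul (hpow n x hx _) ((hF' k x hx).trans (le_abs_self _)) (abs_nonneg _)
        zero_le_one
    have h3 : |F' k| ≤ ∑ k, |F' k| :=
      Finset.single_le_sum (f := fun k => |F' k|) (fun k _ => abs_nonneg _) (Finset.mem_univ k)
    have h4 := abs_nonneg F
    refine (abs_add_le _ _).trans ?_
    linarith
  · filter_upwards [glueₗ_apply fun i => baryPoly i ^ (j + 1) * f,
      ae_restrict_mem isOpen_refTri.measurableSet] with x ⟨i, hi, hx⟩ hxT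
    rw [hx, hl]
    exact ((tendsto_refBump hε hεpos hxT hi).1.pow (j + 1)).const_mul _
  · filter_upwards [glueₗ_apply fun i => MvPolynomial.pderiv k (baryPoly i ^ (j + 1) * f),
      ae_restrict_mem isOpen_refTri.measurableSet] with x ⟨i, hi, hx⟩ hxT
    have ht := tendsto_refBump hε hεpos hxT hi
    rw [hx, ← pderiv_polyFun, hl,
      pderiv_mul_pow hfd ((contDiff_bary i).differentiable (by simp))]
    simp only [fun n => pderiv_mul_pow hfd (hbd n) j k x]
    exact ((((ht.1.pow j).const_mul _).mul (ht.2 k)).const_mul _).add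
      ((ht.1.pow (j + 1)).mul_const _)

/-! ### Surjectivity of the divergence on the reference triangle -/

/-- The divergence of the vector field `μ ^ (j + 1) f t`, where `t` is the edge vector from the
vertex `m` to the vertex `i` and `μ` is the smallest barycentric coordinate. -/
theorem glueₗ_edgeDeriv_mem_range {n j : ℕ} (i m : Fin 3) {f : MvPolynomial (Fin 2) ℝ}
    (hf : j + f.totalDegree ≤ n) : (glueₗ fun r => edgeDeriv i m (baryPoly r ^ (j + 1) * f)) ∈
      LinearMap.range (divₗ (𝒯 := Set.range refPiece) (n := n + 1) isOpen_refTri) := by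
  set t : Fin 2 → ℝ := fun k => (refVertex i - refVertex m) k
  have hg := glueₗ_pow_mul_mem_sobolevGraph j f
  set v := glueₗ fun r => baryPoly r ^ (j + 1) * f
  have hv : v ∈ piecewisePoly refTri (Set.range refPiece) (n + 1) := by
    refine glueₗ_mem_piecewisePoly fun r => (MvPolynomial.totalDegree_mul _ _).trans ?_
    have h1 := MvPolynomial.totalDegree_pow (baryPoly r) (j + 1)
    have h2 := Nat.mul_le_mul_left (j + 1) (totalDegree_baryPoly_le r)
    omega
  have hv' := mem_H10_of_mem_sobolevGraph isOpen_refTri hg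
  refine ⟨⟨fun k => t k • v, (mem_velocity isOpen_refTri).2 fun k => ⟨?_, ?_⟩⟩, ?_⟩
  · exact (piecewisePolySub _ _ _).smul_mem (t k) hv
  · rw [← mem_sobolevZero isOpen_refTri] at hv' ⊢
    exact (sobolevZero refTri).smul_mem (t k) hv'
  · rw [divₗ_apply, divergence]
    simp only [weakPartial_smul isOpen_refTri hv',
      weakPartial_of_mem_sobolevGraph isOpen_refTri hg]
    simp only [← map_smul, ← map_sum]
    congr 1
    funext r
    simp [edgeDeriv, t, MvPolynomial.smul_eq_C_mul]
    ring

theorem setIntegral_glueₗ_pow_ne_zero (n : ℕ) :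
    ∫ x in refTri, glueₗ (Pi.single 0 (baryPoly 0 ^ n)) x ≠ 0 := by
  intro h
  have hval : ∀ x, polyFun (baryPoly 0 ^ n) x = bary 0 x ^ n := fun x => by
    simp [polyFun, bary]
  have hnn : ∀ᵐ x ∂(volume.restrict refTri),
      0 ≤ glueₗ (Pi.single 0 (baryPoly 0 ^ n)) x := by
    filter_upwards [glueₗ_apply (Pi.single 0 (baryPoly 0 ^ n)),
      ae_restrict_mem isOpen_refTri.measurableSet] with x ⟨i, hi, hx⟩ hxT
    rw [hx]
    by_cases h0 : i = 0
    · subst h0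
      rw [Pi.single_eq_same, hval]
      exact pow_nonneg (hxT 0).le n
    · rw [Pi.single_eq_of_ne h0]
      simp [polyFun]
  rw [integral_eq_zero_iff_of_nonneg_ae hnn (L2_integrable isBounded_refTri _)] at h
  have hz : ∀ᵐ x ∂(volume : Measure Plane), x ∉ refTri ∩ refCell 0 := by
    filter_upwards [(ae_restrict_iff' isOpen_refTri.measurableSet).1
      (h.and (glueₗ_apply (Pi.single 0 (baryPoly 0 ^ n))))] with x hx hx'
    obtain ⟨h1, i, hi, h2⟩ := hx hx'.1
    rw [eq_of_mem_refCell hi hx'.2, Pi.single_eq_same, hval, h1] at h2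
    exact (pow_pos (hx'.1 0) n).ne h2
  have hpos := (isOpen_refTri.inter (isOpen_refCell 0)).measure_pos volume
    ⟨!₂[2 / 5, 2 / 5], fun i => ?_, fun i hi => ?_⟩
  · exact hpos.ne' (measure_eq_zero_iff_ae_notMem.2 hz)
  · fin_cases i
    all_goals simp [bary_zero, bary_one, bary_two]
    norm_num
  · fin_cases i
    · exact absurd rfl hi
    all_goals simp [bary_zero, bary_one, bary_two]; norm_num

/-- On the reference triangle, every pressure is the divergence of a velocity. Up to divergences,
a pressure is a multiple of one fixed function with nonzero mean, and its own mean vanishes. -/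
theorem exists_divₗ_eq {n : ℕ} {q : L2 refTri}
    (hq : q ∈ pressureSub isBounded_refTri (Set.range refPiece) n) :
    ∃ w : velocity refTri (Set.range refPiece) (n + 1), divₗ isOpen_refTri w = q := by
  set D := divₗ (𝒯 := Set.range refPiece) (n := n + 1) isOpen_refTri
  obtain ⟨P, hP, rfl⟩ := exists_glueₗ_eq hq.1
  set e := glueₗ (Pi.single 0 (baryPoly 0 ^ n)) with he
  have key := single_mem_of_edgeDeriv_mem (n := n)
    (J := (LinearMap.range D ⊔ Submodule.span ℝ {e}).comap glueₗ)
    (fun i m j f hf => Submodule.mem_sup_left (glueₗ_edgeDeriv_mem_range i m hf))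
    (Submodule.mem_sup_right (Submodule.mem_span_singleton_self e)) n 0 (zero_add n)
  have hmem : glueₗ P ∈ LinearMap.range D ⊔ Submodule.span ℝ {e} := by
    have := Submodule.sum_mem _ fun i (_ : i ∈ Finset.univ) => key i (P i) (hP i)
    simp only [pow_zero, one_mul, Finset.univ_sum_single] at this
    exact this
  obtain ⟨_, ⟨w, rfl⟩, y, hy, hwy⟩ := Submodule.mem_sup.1 hmem
  obtain ⟨c, rfl⟩ := Submodule.mem_span_singleton.1 hy
  have hDw := (divₗ_mem_pressureSub isOpen_refTri isBounded_refTri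
    (Set.forall_mem_range.2 convex_refPiece) w)
  have hce : c • e ∈ pressureSub isBounded_refTri (Set.range refPiece) n := by
    rw [← eq_sub_iff_add_eq'] at hwy
    rw [hwy]
    exact (pressureSub isBounded_refTri (Set.range refPiece) n).sub_mem hq hDw
  have hc : c = 0 := by
    by_contra h0
    have h1 := (pressureSub isBounded_refTri (Set.range refPiece) n).smul_mem c⁻¹ hce
    rw [smul_smul, inv_mul_cancel₀ h0, one_smul] at h1
    exact setIntegral_glueₗ_pow_ne_zero n h1.2
  rw [hc, zero_smul, add_zero] at hwy
  exact ⟨w, hwy⟩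

/-- On the reference triangle, the divergence has a bounded right inverse. -/
theorem exists_bounded_right_inverse (n : ℕ) : ∃ C : ℝ, 0 ≤ C ∧
    ∀ q ∈ pressureSub isBounded_refTri (Set.range refPiece) n,
      ∃ w : velocity refTri (Set.range refPiece) (n + 1),
        divₗ isOpen_refTri w = q ∧ ‖gradₗ isOpen_refTri w‖ ≤ C * ‖q‖ := by
  set D := divₗ (𝒯 := Set.range refPiece) (n := n + 1) isOpen_refTri
  obtain ⟨s, hs⟩ := D.rangeRestrict.exists_rightInverse_of_surjective D.range_rangeRestrict
  have hle : pressureSub isBounded_refTri (Set.range refPiece) n ≤ LinearMap.range D :=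
    fun q hq => exists_divₗ_eq hq
  let S := s ∘ₗ Submodule.inclusion hle
  let T := LinearMap.toContinuousLinearMap (gradₗ isOpen_refTri ∘ₗ S)
  refine ⟨‖T‖, T.opNorm_nonneg, fun q hq => ⟨S ⟨q, hq⟩, ?_, T.le_opNorm ⟨q, hq⟩⟩⟩
  exact congrArg Subtype.val (LinearMap.congr_fun hs (Submodule.inclusion hle ⟨q, hq⟩))

end Glue

/-! ### The affine map from the reference triangle -/

section Triangle

variable (K : Triangle)

/-- The vertices of a triangle as an affine basis of the plane. -/
def triBasis : AffineBasis (Fin 3) ℝ Plane where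
  toFun := K.points
  ind' := K.independent
  tot' := (K.independent.affineSpan_eq_top_iff_card_eq_finrank_add_one).2 (by simp)

theorem coe_triBasis : ⇑(triBasis K) = K.points := rfl

/-- The linear part of the affine map from the reference triangle to `K`. -/
def triLinear : Plane →ₗ[ℝ] Plane where
  toFun x := x 0 • (K.points 1 - K.points 0) + x 1 • (K.points 2 - K.points 0)
  map_add' x y := by
    simp only [PiLp.add_apply]
    module
  map_smul' c x := by
    simp only [PiLp.smul_apply, smul_eq_mul, RingHom.id_apply]
    module

theorem triLinear_apply (x : Plane) : triLinear K x =
    x 0 • (K.points 1 - K.points 0) + x 1 • (K.points 2 - K.points 0) := rfl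

theorem coord_add_triLinear (i : Fin 3) (x : Plane) :
    (triBasis K).coord i (triLinear K x + K.points 0) = bary i x := by
  have h := ((triBasis K).coord i).map_vadd (K.points 0) (triLinear K x)
  have h1 : ∀ m, (triBasis K).coord i (K.points m) = if i = m then 1 else 0 :=
    fun m => (triBasis K).coord_apply i m
  have h2 : ∀ m, ((triBasis K).coord i).linear (K.points m - K.points 0)
      = (if i = m then 1 else 0) - (if i = 0 then 1 else 0) := fun m => by
    rw [← h1, ← h1]
    exact ((triBasis K).coord i).linearMap_vsub _ _
  rw [vadd_eq_add, vadd_eq_add] at h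
  rw [h, triLinear_apply, map_add, map_smul, map_smul, h2, h2, h1]
  fin_cases i
  · simp [bary_zero]; ring
  · simp [bary_one]
  · simp [bary_two]

theorem triLinear_injective : Function.Injective (triLinear K) := by
  intro x y h
  have key : ∀ i, bary i x = bary i y := fun i => by
    rw [← coord_add_triLinear K, ← coord_add_triLinear K, h]
  have h1 := key 1
  have h2 := key 2
  rw [bary_one, bary_one] at h1
  rw [bary_two, bary_two] at h2
  ext i
  fin_cases i
  · exact h1
  · exact h2

/-- The affine map that takes the vertices of the reference triangle to those of `K`. -/
def triMap : Plane ≃ᵃ[ℝ] Plane :=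
  (LinearEquiv.ofInjectiveEndo (triLinear K) (triLinear_injective K)).toAffineEquiv.trans
    (AffineEquiv.constVAdd ℝ Plane (K.points 0))

theorem triMap_apply (x : Plane) : triMap K x = triLinear K x + K.points 0 := by
  rw [add_comm]
  rfl

theorem linear_triMap (x : Plane) : (triMap K).linear x = triLinear K x := rfl

theorem coord_triMap (i : Fin 3) (x : Plane) :
    (triBasis K).coord i (triMap K x) = bary i x := by
  rw [triMap_apply, coord_add_triLinear]

theorem bary_triMap_symm (i : Fin 3) (y : Plane) :
    bary i ((triMap K).symm y) = (triBasis K).coord i y := by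
  rw [← coord_triMap K, AffineEquiv.apply_symm_apply]

theorem triMap_eq_sum (x : Plane) : triMap K x = ∑ i, bary i x • K.points i := by
  rw [triMap_apply, triLinear_apply, Fin.sum_univ_three, bary_zero, bary_one, bary_two]
  module

theorem mem_closedTri_iff {y : Plane} :
    y ∈ closedTri K ↔ ∀ i, 0 ≤ bary i ((triMap K).symm y) := by
  simp only [bary_triMap_symm]
  rw [closedTri, ← coe_triBasis, (triBasis K).convexHull_eq_nonneg_coord]
  rfl

theorem mem_openTri_iff {y : Plane} :
    y ∈ openTri K ↔ ∀ i, 0 < bary i ((triMap K).symm y) := by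
  simp only [bary_triMap_symm]
  rw [openTri, closedTri, ← coe_triBasis, (triBasis K).interior_convexHull]
  rfl

theorem openTri_eq_preimage : openTri K = (triMap K).symm ⁻¹' refTri :=
  Set.ext fun _ => mem_openTri_iff K

theorem refTri_eq_preimage : refTri = triMap K ⁻¹' openTri K := by
  ext x
  rw [Set.mem_preimage, mem_openTri_iff, AffineEquiv.symm_apply_apply]
  rfl

theorem isBounded_closedTri : Bornology.IsBounded (closedTri K) :=
  ((Set.finite_range K.points).isCompact_convexHull ℝ).isBounded

theorem isBounded_openTri : Bornology.IsBounded (openTri K) :=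
  (isBounded_closedTri K).subset interior_subset

theorem centroid_eq_sum :
    Finset.univ.centroid ℝ K.points = ∑ i, (1 / 3 : ℝ) • K.points i := by
  rw [Finset.centroid_def, Finset.affineCombination_eq_linear_combination _ _ _
    (Finset.sum_centroidWeights_eq_one_of_nonempty ℝ _ ⟨0, Finset.mem_univ _⟩)]
  simp

theorem convex_of_mem_barycentricRefinement :
    ∀ T ∈ barycentricRefinement K, Convex ℝ T := by
  rintro _ ⟨i, rfl⟩
  exact convex_convexHull ℝ _

/-- The `i`-th triangle of the barycentric refinement consists of the points whose `i`-th
barycentric coordinate is the smallest. -/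
theorem mapsTo_triMap (i : Fin 3) : Set.MapsTo (triMap K) (refPiece i)
    (convexHull ℝ (insert (Finset.univ.centroid ℝ K.points) (K.points '' {i}ᶜ))) := by
  intro x hx
  obtain ⟨c, hc⟩ : ∃ c, c = Finset.univ.centroid ℝ K.points := ⟨_, rfl⟩
  rw [← hc]
  let z : Fin 3 → Plane := fun m => if m = i then c else K.points m
  let w : Fin 3 → ℝ := fun m => if m = i then 3 * bary i x else bary m x - bary i x
  have hz : ∀ m, z m ∈ convexHull ℝ (insert c (K.points '' {i}ᶜ)) := fun m => by
    by_cases hm : m = i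
    · simp only [z, if_pos hm]
      exact subset_convexHull ℝ _ (Set.mem_insert _ _)
    · simp only [z, if_neg hm]
      exact subset_convexHull ℝ _ (Set.mem_insert_of_mem _ ⟨m, hm, rfl⟩)
  have hw : ∀ m, 0 ≤ w m := fun m => by
    by_cases hm : m = i
    · simp only [w, if_pos hm]; linarith [hx.1]
    · simp only [w, if_neg hm]; linarith [hx.2 m]
  have hsum := sum_bary x
  have hi : i = 0 ∨ i = 1 ∨ i = 2 := by fin_cases i <;> simp
  have hw1 : ∑ m, w m = 1 := by
    rw [Fin.sum_univ_three]
    obtain rfl | rfl | rfl := hi <;> simp [w] <;> linarith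
  have e : triMap K x = ∑ m, w m • z m := by
    rw [centroid_eq_sum, Fin.sum_univ_three] at hc
    rw [triMap_eq_sum, Fin.sum_univ_three, Fin.sum_univ_three]
    obtain rfl | rfl | rfl := hi <;> simp [w, z] <;> rw [hc] <;> module
  rw [e]
  exact (convex_convexHull ℝ _).sum_mem (fun m _ => hw m) hw1 fun m _ => hz m

theorem mapsTo_triMap_symm (i : Fin 3) : Set.MapsTo (triMap K).symm
    (convexHull ℝ (insert (Finset.univ.centroid ℝ K.points) (K.points '' {i}ᶜ)))
    (refPiece i) := by
  refine convexHull_min ?_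
    ((convex_refPiece i).affine_preimage ((triMap K).symm : Plane →ᵃ[ℝ] Plane))
  have hp : ∀ j m, bary j ((triMap K).symm (K.points m)) = if j = m then 1 else 0 := fun j m => by
    rw [bary_triMap_symm]
    exact (triBasis K).coord_apply j m
  rintro y (rfl | ⟨m, hm, rfl⟩)
  · have hc : ∀ j, bary j ((triMap K).symm (Finset.univ.centroid ℝ K.points)) = 1 / 3 :=
      fun j => by
        rw [bary_triMap_symm, ← coe_triBasis]
        exact ((triBasis K).coord_apply_centroid (Finset.mem_univ j)).trans (by simp)
    refine ⟨?_, fun m => ?_⟩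
    · exact (hc i).symm ▸ by norm_num
    · exact ((hc i).trans (hc m).symm).le
  · have h0 : bary i ((triMap K).symm (K.points m)) = 0 := by
      rw [hp, if_neg fun h => hm h.symm]
    refine ⟨h0.ge, fun j => h0.le.trans ?_⟩
    exact (hp j m).symm ▸ by split_ifs <;> norm_num

variable {K}

theorem pull_triMap_mem_piecewisePoly {n : ℕ} {v : L2 (openTri K)}
    (hv : v ∈ piecewisePoly (openTri K) (barycentricRefinement K) n) :
    pull (triMap K) (refTri_eq_preimage K) v ∈ piecewisePoly refTri (Set.range refPiece) n := by
  refine pull_mem_piecewisePoly _ _ ?_ hv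
  rintro _ ⟨i, rfl⟩
  exact ⟨_, ⟨i, rfl⟩, mapsTo_triMap K i⟩

theorem pull_triMap_symm_mem_piecewisePoly {n : ℕ} {v : L2 refTri}
    (hv : v ∈ piecewisePoly refTri (Set.range refPiece) n) :
    pull (triMap K).symm (openTri_eq_preimage K) v ∈
      piecewisePoly (openTri K) (barycentricRefinement K) n := by
  refine pull_mem_piecewisePoly _ _ ?_ hv
  rintro _ ⟨i, rfl⟩
  exact ⟨_, ⟨i, rfl⟩, mapsTo_triMap_symm K i⟩

instance finiteDimensional_piecewisePolySub_openTri (n : ℕ) :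
    FiniteDimensional ℝ (piecewisePolySub (openTri K) (barycentricRefinement K) n) := by
  let f : piecewisePolySub (openTri K) (barycentricRefinement K) n →ₗ[ℝ]
      piecewisePolySub refTri (Set.range refPiece) n :=
    (pull (triMap K) (refTri_eq_preimage K)).toLinearMap.restrict
      fun v hv => pull_triMap_mem_piecewisePoly hv
  refine FiniteDimensional.of_injective f fun u v h => Subtype.ext ?_
  exact pull_injective (triMap K) (refTri_eq_preimage K) (congrArg Subtype.val h)

/-! ### Shape regularity -/

theorem abs_linear_triMap_le (k i : Fin 2) :
    |(triMap K).linear (EuclideanSpace.single k 1) i| ≤ Metric.diam (closedTri K) := by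
  have h : ∀ m, K.points m ∈ closedTri K := fun m => subset_convexHull ℝ _ ⟨m, rfl⟩
  have e : (triMap K).linear (EuclideanSpace.single k 1) = K.points k.succ - K.points 0 := by
    rw [linear_triMap, triLinear_apply]
    fin_cases k <;> simp
  rw [e]
  refine (PiLp.norm_apply_le (K.points k.succ - K.points 0) i).trans ?_
  rw [← dist_eq_norm]
  exact Metric.dist_le_diam_of_mem (isBounded_closedTri K) (h _) (h _)

/-- If a ball of radius `r` is contained in `K`, the inverse map `K → K̂` changes coordinates by at
most one over distances of length `r`. -/
theorem abs_linear_triMap_symm_mul_le {x : Plane} {r : ℝ} (hr : 0 ≤ r)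
    (h : Metric.closedBall x r ⊆ closedTri K) (j m : Fin 2) :
    |(triMap K).symm.linear (EuclideanSpace.single j 1) m| * r ≤ 1 := by
  have h01 : ∀ y ∈ closedTri K, ((triMap K).symm y) m ∈ Set.Icc (0 : ℝ) 1 := fun y hy => by
    have h0 := (mem_closedTri_iff K).1 hy
    have hs := sum_bary ((triMap K).symm y)
    have h1 := h0 0
    have h2 := h0 1
    have h3 := h0 2
    rw [bary_one, bary_two] at hs
    rw [bary_one] at h2
    rw [bary_two] at h3
    fin_cases m <;> constructor <;> simp <;> linarith
  have hx := h01 x (h (Metric.mem_closedBall_self hr))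
  have hy := h01 (r • EuclideanSpace.single j 1 + x) (h (by simp [norm_smul, abs_of_nonneg hr]))
  have e : (triMap K).symm (r • EuclideanSpace.single j 1 + x) m =
      r * (triMap K).symm.linear (EuclideanSpace.single j 1) m + (triMap K).symm x m := by
    have := (triMap K).symm.map_vadd x (r • EuclideanSpace.single j (1 : ℝ))
    rw [vadd_eq_add, vadd_eq_add] at this
    rw [this]
    simp
  rw [e] at hy
  have h3 : |r * (triMap K).symm.linear (EuclideanSpace.single j 1) m| ≤ 1 := by
    rw [abs_le]
    constructor <;> linarith [hx.1, hx.2, hy.1, hy.2]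
  rwa [abs_mul, abs_of_nonneg hr, mul_comm] at h3

theorem abs_linear_triMap_symm_mul_inballDiam_le (j m : Fin 2) :
    |(triMap K).symm.linear (EuclideanSpace.single j 1) m| * inballDiam K ≤ 2 := by
  set a := |(triMap K).symm.linear (EuclideanSpace.single j 1) m| with ha
  rcases (abs_nonneg ((triMap K).symm.linear (EuclideanSpace.single j 1) m)).eq_or_lt with h0 | h0
  · rw [ha, ← h0, zero_mul]; norm_num
  rw [← ha] at h0
  rw [mul_comm, ← le_div_iff₀ h0]
  refine csSup_le ⟨0, K.points 0, 0, le_rfl, by simp, ?_⟩ ?_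
  · rw [Metric.closedBall_zero, Set.singleton_subset_iff]
    exact subset_convexHull ℝ _ ⟨0, rfl⟩
  · rintro _ ⟨x, r, hr, rfl, hx⟩
    have := abs_linear_triMap_symm_mul_le hr hx j m
    rw [le_div_iff₀ h0]
    linarith

theorem inballDiam_pos : 0 < inballDiam K := by
  have hne : (openTri K).Nonempty := by
    refine ⟨triMap K !₂[1 / 3, 1 / 3], (mem_openTri_iff K).2 fun i => ?_⟩
    rw [AffineEquiv.symm_apply_apply]
    fin_cases i
    all_goals simp [bary_zero, bary_one, bary_two]
    norm_num
  obtain ⟨x, hx⟩ := hne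
  obtain ⟨r, hr, hxr⟩ := Metric.nhds_basis_closedBall.mem_iff.1 ((isOpen_openTri K).mem_nhds hx)
  refine lt_of_lt_of_le (by positivity : 0 < 2 * r)
    (le_csSup ⟨2 * Metric.diam (closedTri K), ?_⟩
      ⟨x, r, hr.le, rfl, hxr.trans interior_subset⟩)
  rintro _ ⟨y, s, hs, rfl, hy⟩
  have h1 : s • EuclideanSpace.single 0 1 + y ∈ closedTri K := hy (by simp [norm_smul, abs_of_nonneg hs])
  have h2 := Metric.dist_le_diam_of_mem (isBounded_closedTri K) h1
    (hy (Metric.mem_closedBall_self hs))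
  simp [norm_smul, abs_of_nonneg hs] at h2
  linarith

theorem abs_mul_abs_le_div (i j k m : Fin 2) :
    |(triMap K).linear (EuclideanSpace.single k 1) i| *
      |(triMap K).symm.linear (EuclideanSpace.single j 1) m| ≤
        2 * (Metric.diam (closedTri K) / inballDiam K) := by
  have h1 := abs_linear_triMap_le (K := K) k i
  have h2 := abs_linear_triMap_symm_mul_inballDiam_le (K := K) j m
  rw [← le_div_iff₀ inballDiam_pos] at h2
  refine (mul_le_mul h1 h2 (abs_nonneg _) Metric.diam_nonneg).trans (le_of_eq ?_)
  ring

theorem div_le_shapeParameter {M : Finset Triangle} (hK : K ∈ M) :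
    Metric.diam (closedTri K) / inballDiam K ≤ shapeParameter M :=
  le_ciSup (f := fun K : {K // K ∈ M} => Metric.diam (closedTri K.1) / inballDiam K.1)
    (Set.finite_range _).bddAbove ⟨K, hK⟩

/-! ### The divergence on a general triangle -/

/-- The Piola transform of a velocity on the reference triangle. -/
def piola (K : Triangle) (w : Fin 2 → L2 refTri) (i : Fin 2) : L2 (openTri K) :=
  ∑ k, (triMap K).linear (EuclideanSpace.single k 1) i •
    pull (triMap K).symm (openTri_eq_preimage K) (w k)

theorem piola_mem_velocity {n : ℕ} {w : Fin 2 → L2 refTri}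
    (hw : w ∈ velocity refTri (Set.range refPiece) n) :
    piola K w ∈ velocity (openTri K) (barycentricRefinement K) n := by
  rw [mem_velocity isOpen_refTri] at hw
  rw [mem_velocity (isOpen_openTri K)]
  refine fun i => ⟨?_, ?_⟩
  · exact (piecewisePolySub (openTri K) (barycentricRefinement K) n).sum_mem fun k _ =>
      (piecewisePolySub _ _ _).smul_mem _ (pull_triMap_symm_mem_piecewisePoly (hw k).1)
  · rw [← mem_sobolevZero (isOpen_openTri K)]
    refine (sobolevZero (openTri K)).sum_mem fun k _ => (sobolevZero _).smul_mem _ ?_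
    rw [mem_sobolevZero (isOpen_openTri K)]
    exact pull_mem_H10 _ _ (isOpen_openTri K) isOpen_refTri (hw k).2

theorem weakPartial_piola {w : Fin 2 → L2 refTri} (hw : ∀ k, w k ∈ H10 refTri) (i j : Fin 2) :
    weakPartial (openTri K) j (piola K w i) =
      ∑ k, ∑ m, ((triMap K).linear (EuclideanSpace.single k 1) i *
        (triMap K).symm.linear (EuclideanSpace.single j 1) m) •
          pull (triMap K).symm (openTri_eq_preimage K) (weakPartial refTri m (w k)) := by
  have hO := isOpen_openTri K
  have hp : ∀ k, pull (triMap K).symm (openTri_eq_preimage K) (w k) ∈ H10 (openTri K) :=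
    fun k => pull_mem_H10 _ _ hO isOpen_refTri (hw k)
  have hs : ∀ (k : Fin 2) (c : ℝ),
      c • pull (triMap K).symm (openTri_eq_preimage K) (w k) ∈ H10 (openTri K) := fun k c => by
    rw [← mem_sobolevZero hO]
    exact (sobolevZero _).smul_mem c ((mem_sobolevZero hO).2 (hp k))
  rw [piola, Fin.sum_univ_two, weakPartial_add hO (hs 0 _) (hs 1 _), weakPartial_smul hO (hp 0),
    weakPartial_smul hO (hp 1), weakPartial_pull _ _ hO isOpen_refTri (hw 0),
    weakPartial_pull _ _ hO isOpen_refTri (hw 1)]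
  simp only [Fin.sum_univ_two, smul_add, smul_smul]

/-- The Piola transform preserves the divergence. -/
theorem divergence_piola {w : Fin 2 → L2 refTri} (hw : ∀ k, w k ∈ H10 refTri) :
    divergence (openTri K) (piola K w) =
      pull (triMap K).symm (openTri_eq_preimage K) (divergence refTri w) := by
  have hinv : ∀ k m, ∑ i, (triMap K).linear (EuclideanSpace.single k 1) i *
      (triMap K).symm.linear (EuclideanSpace.single i 1) m = if m = k then 1 else 0 := by
    intro k m
    have h1 : (triMap K).symm.linear ((triMap K).linear (EuclideanSpace.single k 1)) =
        EuclideanSpace.single k 1 := (triMap K).linear.symm_apply_apply _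
    have h2 : ∀ y : Plane, y = ∑ i, y i • EuclideanSpace.single i (1 : ℝ) := fun y => by
      ext j; fin_cases j <;> simp
    rw [h2 ((triMap K).linear (EuclideanSpace.single k 1)), map_sum] at h1
    have h3 := congrArg (fun y : Plane => y m) h1
    simpa [Fin.sum_univ_two] using h3
  simp only [divergence, weakPartial_piola hw, map_sum]
  rw [Finset.sum_comm]
  refine Finset.sum_congr rfl fun k _ => ?_
  rw [Finset.sum_comm]
  simp only [← Finset.sum_smul, hinv]
  simp

theorem norm_weakPartial_piola_le {w : Fin 2 → L2 refTri} (hw : ∀ k, w k ∈ H10 refTri) {B : ℝ}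
    (hB : ∀ k m, ‖pull (triMap K).symm (openTri_eq_preimage K) (weakPartial refTri m (w k))‖ ≤ B)
    (i j : Fin 2) : ‖weakPartial (openTri K) j (piola K w i)‖ ≤
      8 * (Metric.diam (closedTri K) / inballDiam K) * B := by
  have hR : 0 ≤ Metric.diam (closedTri K) / inballDiam K :=
    div_nonneg Metric.diam_nonneg inballDiam_pos.le
  rw [weakPartial_piola hw]
  have hkm : ∀ k m, ‖((triMap K).linear (EuclideanSpace.single k 1) i *
      (triMap K).symm.linear (EuclideanSpace.single j 1) m) •
        pull (triMap K).symm (openTri_eq_preimage K) (weakPartial refTri m (w k))‖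
      ≤ 2 * (Metric.diam (closedTri K) / inballDiam K) * B := fun k m => by
    rw [norm_smul, Real.norm_eq_abs, abs_mul]
    exact mul_le_mul (abs_mul_abs_le_div i j k m) (hB k m) (norm_nonneg _) (by positivity)
  refine (norm_sum_le_of_le _ fun k _ => norm_sum_le_of_le _ fun m _ => hkm k m).trans ?_
  rw [Fin.sum_univ_two, Fin.sum_univ_two]
  linarith

theorem gradNorm_le {U : Set Plane} {u : Fin 2 → L2 U} {B : ℝ} (hB0 : 0 ≤ B)
    (hB : ∀ i j, ‖weakPartial U j (u i)‖ ≤ B) : gradNorm U u ≤ 2 * B := by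
  refine Real.sqrt_le_iff.2 ⟨by positivity, ?_⟩
  refine (Finset.sum_le_sum fun i _ => Finset.sum_le_sum fun j _ =>
    pow_le_pow_left₀ (norm_nonneg _) (hB i j) 2).trans (le_of_eq ?_)
  simp only [Fin.sum_univ_two]
  ring

/-- On any triangle, the divergence has a right inverse whose norm is bounded in terms of the
shape of the triangle. -/
theorem exists_divₗ_eq_and_norm_le (n : ℕ) : ∃ C : ℝ, 0 ≤ C ∧ ∀ K : Triangle,
    ∀ q ∈ pressureSub (isBounded_openTri K) (barycentricRefinement K) n,
      ∃ w : velocity (openTri K) (barycentricRefinement K) (n + 1),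
        divₗ (isOpen_openTri K) w = q ∧ ‖gradₗ (isOpen_openTri K) w‖ ≤
          C * (Metric.diam (closedTri K) / inballDiam K) * ‖q‖ := by
  obtain ⟨C, hC, h⟩ := exists_bounded_right_inverse n
  refine ⟨16 * C, by positivity, fun K q hq => ?_⟩
  obtain ⟨q', hq'⟩ : ∃ q', q' = pull (triMap K) (refTri_eq_preimage K) q := ⟨_, rfl⟩
  have hback : pull (triMap K).symm (openTri_eq_preimage K) q' = q := by
    rw [hq']
    exact pull_symm_pull (triMap K) (refTri_eq_preimage K) (openTri_eq_preimage K) q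
  have hmem : q' ∈ pressureSub isBounded_refTri (Set.range refPiece) n := by
    rw [hq']
    exact ⟨pull_triMap_mem_piecewisePoly hq.1, pull_mem_L2Zero _ _ hq.2⟩
  obtain ⟨w, hw, hwC⟩ := h q' hmem
  have hw' : ∀ k, w.1 k ∈ H10 refTri := fun k => ((mem_velocity isOpen_refTri).1 w.2 k).2
  refine ⟨⟨piola K w, piola_mem_velocity w.2⟩, ?_, ?_⟩
  · rw [divₗ_apply] at hw ⊢
    rw [divergence_piola hw', hw, hback]
  have hpull : ∀ k m, ‖pull (triMap K).symm (openTri_eq_preimage K)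
      (weakPartial refTri m (w.1 k))‖ ≤ C * ‖q‖ := fun k m => by
    rw [norm_pull, ← hback, norm_pull, mul_left_comm]
    refine mul_le_mul_of_nonneg_left ?_ (normScale_pos _).le
    exact (PiLp.norm_apply_le (gradₗ isOpen_refTri w) (k, m)).trans hwC
  have hR : 0 ≤ Metric.diam (closedTri K) / inballDiam K :=
    div_nonneg Metric.diam_nonneg inballDiam_pos.le
  rw [norm_gradₗ]
  refine (gradNorm_le (by positivity) (norm_weakPartial_piola_le hw' hpull)).trans (le_of_eq ?_)
  ring

end Triangle

/-! ### Discrete saddle point problems -/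

section Saddle

variable {V E L : Type*} [AddCommGroup V] [Module ℝ V]
  [NormedAddCommGroup E] [InnerProductSpace ℝ E] [NormedAddCommGroup L] [InnerProductSpace ℝ L]

/-- `(u, p)` solves the saddle point problem with quadratic form `‖G u‖²`, constraint operator `B`
and multipliers in `Q`. -/
def IsSaddle (G : V →ₗ[ℝ] E) (B : V →ₗ[ℝ] L) (Q : Submodule ℝ L) (q : L) (u : V) (p : Q) : Prop :=
  (∀ v, inner ℝ (G u) (G v) - inner ℝ (p : L) (B v) = 0) ∧
    ∀ r ∈ Q, inner ℝ r (B u) = inner ℝ r q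

variable {G : V →ₗ[ℝ] E} {B : V →ₗ[ℝ] L} {Q : Submodule ℝ L}

theorem IsSaddle.add {q q' : L} {u u' : V} {p p' : Q} (h : IsSaddle G B Q q u p)
    (h' : IsSaddle G B Q q' u' p') : IsSaddle G B Q (q + q') (u + u') (p + p') := by
  refine ⟨fun v => ?_, fun r hr => ?_⟩
  · have h1 := h.1 v
    have h2 := h'.1 v
    simp only [map_add, inner_add_left, Submodule.coe_add]
    linarith
  · rw [map_add, inner_add_right, inner_add_right, h.2 r hr, h'.2 r hr]

theorem IsSaddle.smul {q : L} {u : V} {p : Q} (h : IsSaddle G B Q q u p) (c : ℝ) :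
    IsSaddle G B Q (c • q) (c • u) (c • p) := by
  refine ⟨fun v => ?_, fun r hr => ?_⟩
  · have h1 := h.1 v
    simp only [map_smul, real_inner_smul_left, Submodule.coe_smul]
    rw [← mul_sub, h1, mul_zero]
  · rw [map_smul, real_inner_smul_right, real_inner_smul_right, h.2 r hr]

theorem IsSaddle.eq_zero (hG : ∀ u, G u = 0 → u = 0) (hB : ∀ r ∈ Q, ∃ w, B w = r)
    {u : V} {p : Q} (h : IsSaddle G B Q 0 u p) : u = 0 ∧ p = 0 := by
  have hu : u = 0 := hG u <| by
    have h1 := h.1 u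
    rw [h.2 p p.2, inner_zero_right, sub_zero] at h1
    exact inner_self_eq_zero.1 h1
  refine ⟨hu, ?_⟩
  obtain ⟨w, hw⟩ := hB p p.2
  have h1 := h.1 w
  rw [hu, hw, map_zero, inner_zero_left, zero_sub, neg_eq_zero] at h1
  exact Subtype.ext (inner_self_eq_zero.1 h1)

theorem IsSaddle.unique (hG : ∀ u, G u = 0 → u = 0) (hB : ∀ r ∈ Q, ∃ w, B w = r) {q : L}
    {u u' : V} {p p' : Q} (h : IsSaddle G B Q q u p) (h' : IsSaddle G B Q q u' p') :
    u = u' ∧ p = p' := by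
  have := h.add (h'.smul (-1))
  simp only [neg_smul, one_smul, ← sub_eq_add_neg, sub_self] at this
  have h0 := this.eq_zero hG hB
  exact ⟨sub_eq_zero.1 h0.1, sub_eq_zero.1 h0.2⟩

/-- Existence follows from uniqueness, since the problem is a linear system in finite dimension with
as many equations as unknowns. -/
theorem IsSaddle.exists [FiniteDimensional ℝ V] (hG : ∀ u, G u = 0 → u = 0) [FiniteDimensional ℝ Q]
    (hB : ∀ r ∈ Q, ∃ w, B w = r) (q : L) : ∃ u p, IsSaddle G B Q q u p := by
  let S : V × Q →ₗ[ℝ] Module.Dual ℝ V × Module.Dual ℝ Q :=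
    { toFun := fun x => ((innerₗ E (G x.1)) ∘ₗ G - (innerₗ L (x.2 : L)) ∘ₗ B,
        (innerₗ L (B x.1)) ∘ₗ Q.subtype)
      map_add' := fun x y => by
        refine Prod.ext (LinearMap.ext fun v => ?_) (LinearMap.ext fun r => ?_)
        · simp; ring
        · simp
      map_smul' := fun c x => by
        refine Prod.ext (LinearMap.ext fun v => ?_) (LinearMap.ext fun r => ?_)
        · simp; ring
        · simp }
  have hS : ∀ x q, IsSaddle G B Q q x.1 x.2 ↔ S x = (0, (innerₗ L q) ∘ₗ Q.subtype) := by
    intro x q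
    rw [Prod.ext_iff, LinearMap.ext_iff, LinearMap.ext_iff]
    simp [IsSaddle, S, real_inner_comm]
  have hinj : Function.Injective S := by
    rw [← LinearMap.ker_eq_bot, LinearMap.ker_eq_bot']
    intro x hx
    have h0 : IsSaddle G B Q 0 x.1 x.2 := (hS x 0).2 (by rw [hx]; simp; rfl)
    exact Prod.ext (h0.eq_zero hG hB).1 (h0.eq_zero hG hB).2
  have hdim : Module.finrank ℝ (V × Q) =
      Module.finrank ℝ (Module.Dual ℝ V × Module.Dual ℝ Q) := by
    rw [Module.finrank_prod, Module.finrank_prod, Subspace.dual_finrank_eq,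
      Subspace.dual_finrank_eq]
  obtain ⟨x, hx⟩ := (LinearMap.injective_iff_surjective_of_finrank_eq_finrank hdim).1 hinj
    (0, (innerₗ L q) ∘ₗ Q.subtype)
  exact ⟨x.1, x.2, (hS x q).2 hx⟩

/-- Stability: `u` minimizes `‖G w‖` among all `w` with `B w = P q`, where `P` is the orthogonal
projection onto `Q`. -/
theorem IsSaddle.norm_le [FiniteDimensional ℝ Q] {C : ℝ}
    (hB : ∀ r ∈ Q, ∃ w, B w = r ∧ ‖G w‖ ≤ C * ‖r‖) (hC : 0 ≤ C) {q : L} {u : V} {p : Q}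
    (h : IsSaddle G B Q q u p) : ‖G u‖ ≤ C * ‖q‖ := by
  obtain ⟨w, hw, hw'⟩ := hB _ (Q.orthogonalProjectionOnto q).2
  have hle : ‖G w‖ ≤ C * ‖q‖ :=
    hw'.trans (mul_le_mul_of_nonneg_left (Q.norm_orthogonalProjectionOnto_apply_le q) hC)
  have h1 := h.1 u
  have h2 := h.1 w
  have h3 : inner ℝ (p : L) (B w) = inner ℝ (p : L) (B u) := by
    rw [h.2 p p.2, hw, ← sub_eq_zero, ← inner_sub_right, ← neg_sub, inner_neg_right,
      neg_eq_zero]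
    exact Submodule.inner_right_of_mem_orthogonal p.2
      (Submodule.sub_starProjection_mem_orthogonal q)
  have h4 : ‖G u‖ ^ 2 ≤ ‖G u‖ * ‖G w‖ := by
    rw [← real_inner_self_eq_norm_sq]
    refine le_trans (le_of_eq ?_) (real_inner_le_norm (G u) (G w))
    linarith
  by_cases h0 : ‖G u‖ = 0
  · rw [h0]; positivity
  · have : 0 < ‖G u‖ := lt_of_le_of_ne (norm_nonneg _) (Ne.symm h0)
    nlinarith

/-- If `B` maps into the multiplier space, the constraint holds exactly, not only weakly. -/
theorem IsSaddle.apply_eq (hB : ∀ v, B v ∈ Q) {q : L} (hq : q ∈ Q) {u : V} {p : Q}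
    (h : IsSaddle G B Q q u p) : B u = q := by
  have := h.2 _ (Q.sub_mem (hB u) hq)
  rw [← sub_eq_zero, ← inner_sub_right] at this
  exact sub_eq_zero.1 (inner_self_eq_zero.1 this)

end Saddle

/-! ### The local discrete Stokes problem -/

section Local

variable {K : Triangle} {n : ℕ}

theorem divₗ_mem_pressureSub_openTri
    (u : velocity (openTri K) (barycentricRefinement K) (n + 1)) :
    divₗ (isOpen_openTri K) u ∈
      pressureSub (isBounded_openTri K) (barycentricRefinement K) n :=
  divₗ_mem_pressureSub (isOpen_openTri K) (isBounded_openTri K)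
    (convex_of_mem_barycentricRefinement K) u

/-- The local discrete Stokes problem as an abstract saddle point problem. -/
theorem solvesLocal_iff {q p : L2 (openTri K)} {u : Fin 2 → L2 (openTri K)} :
    SolvesLocal K (n + 1) q u p ↔
      ∃ (hu : u ∈ velocity (openTri K) (barycentricRefinement K) (n + 1))
        (hp : p ∈ pressureSub (isBounded_openTri K) (barycentricRefinement K) n),
        IsSaddle (gradₗ (isOpen_openTri K)) (divₗ (isOpen_openTri K))
          (pressureSub (isBounded_openTri K) (barycentricRefinement K) n) q ⟨u, hu⟩ ⟨p, hp⟩ := by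
  constructor
  · intro h
    refine ⟨(mem_velocity (isOpen_openTri K)).2 h.velocity_mem, h.pressure_mem,
      fun v => ?_, fun r hr => ?_⟩
    · rw [inner_gradₗ, ← integral_mul_eq_inner]
      exact h.momentum v ((mem_velocity (isOpen_openTri K)).1 v.2)
    · rw [← integral_mul_eq_inner, ← integral_mul_eq_inner]
      exact h.continuity r hr
  · rintro ⟨hu, hp, h1, h2⟩
    refine ⟨(mem_velocity (isOpen_openTri K)).1 hu, hp, fun v hv => ?_, fun r hr => ?_⟩
    · have := h1 ⟨v, (mem_velocity (isOpen_openTri K)).2 hv⟩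
      rwa [inner_gradₗ, ← integral_mul_eq_inner] at this
    · have := h2 r hr
      rwa [← integral_mul_eq_inner, ← integral_mul_eq_inner] at this

theorem exists_divₗ_openTri_eq {q : L2 (openTri K)}
    (hq : q ∈ pressureSub (isBounded_openTri K) (barycentricRefinement K) n) :
    ∃ w : velocity (openTri K) (barycentricRefinement K) (n + 1),
      divₗ (isOpen_openTri K) w = q := by
  obtain ⟨C, -, h⟩ := exists_divₗ_eq_and_norm_le n
  obtain ⟨w, hw, -⟩ := h K q hq
  exact ⟨w, hw⟩

theorem SolvesLocal.unique {q p p' : L2 (openTri K)} {u u' : Fin 2 → L2 (openTri K)}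
    (h : SolvesLocal K (n + 1) q u p) (h' : SolvesLocal K (n + 1) q u' p') : u = u' ∧ p = p' := by
  obtain ⟨hu, hp, hs⟩ := solvesLocal_iff.1 h
  obtain ⟨hu', hp', hs'⟩ := solvesLocal_iff.1 h'
  obtain ⟨h1, h2⟩ := hs.unique
    (eq_zero_of_gradₗ_eq_zero (isOpen_openTri K) (isBounded_openTri K))
    (fun r hr => exists_divₗ_openTri_eq hr) hs'
  exact ⟨congrArg Subtype.val h1, congrArg Subtype.val h2⟩

theorem SolvesLocal.exists (q : L2 (openTri K)) : ∃ u p, SolvesLocal K (n + 1) q u p := by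
  obtain ⟨u, p, h⟩ := IsSaddle.exists
    (Q := pressureSub (isBounded_openTri K) (barycentricRefinement K) n)
    (eq_zero_of_gradₗ_eq_zero (𝒯 := barycentricRefinement K) (n := n + 1) (isOpen_openTri K)
      (isBounded_openTri K)) (fun r hr => exists_divₗ_openTri_eq hr) q
  exact ⟨u, p, solvesLocal_iff.2 ⟨u.2, p.2, h⟩⟩

theorem SolvesLocal.add {q q' p p' : L2 (openTri K)} {u u' : Fin 2 → L2 (openTri K)}
    (h : SolvesLocal K (n + 1) q u p) (h' : SolvesLocal K (n + 1) q' u' p') :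
    SolvesLocal K (n + 1) (q + q') (u + u') (p + p') := by
  obtain ⟨hu, hp, hs⟩ := solvesLocal_iff.1 h
  obtain ⟨hu', hp', hs'⟩ := solvesLocal_iff.1 h'
  have e := hs.add hs'
  rw [AddMemClass.mk_add_mk, AddMemClass.mk_add_mk] at e
  exact solvesLocal_iff.2 ⟨_, _, e⟩

theorem SolvesLocal.smul {q p : L2 (openTri K)} {u : Fin 2 → L2 (openTri K)}
    (h : SolvesLocal K (n + 1) q u p) (c : ℝ) :
    SolvesLocal K (n + 1) (c • q) (c • u) (c • p) := by
  obtain ⟨hu, hp, hs⟩ := solvesLocal_iff.1 h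
  have e := hs.smul c
  rw [SetLike.mk_smul_mk, SetLike.mk_smul_mk] at e
  exact solvesLocal_iff.2 ⟨_, _, e⟩

theorem SolvesLocal.mem_H10 {q p : L2 (openTri K)} {u : Fin 2 → L2 (openTri K)}
    (h : SolvesLocal K (n + 1) q u p) (i : Fin 2) : u i ∈ H10 (openTri K) :=
  (h.velocity_mem i).2

theorem SolvesLocal.divergence_eq {q p : L2 (openTri K)} {u : Fin 2 → L2 (openTri K)}
    (h : SolvesLocal K (n + 1) q u p) (hq : q ∈ polyAvg K n) :
    divergence (openTri K) u = q := by
  obtain ⟨hu, hp, hs⟩ := solvesLocal_iff.1 h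
  exact hs.apply_eq divₗ_mem_pressureSub_openTri hq

theorem exists_gradNorm_le_of_solvesLocal (n : ℕ) : ∃ C : ℝ, 0 ≤ C ∧
    ∀ (K : Triangle) (q p : L2 (openTri K)) (u : Fin 2 → L2 (openTri K)),
      SolvesLocal K (n + 1) q u p →
        gradNorm (openTri K) u ≤
          C * (Metric.diam (closedTri K) / inballDiam K) * ‖q‖ := by
  obtain ⟨C, hC, h⟩ := exists_divₗ_eq_and_norm_le n
  refine ⟨C, hC, fun K q p u hs => ?_⟩
  obtain ⟨hu, hp, hs⟩ := solvesLocal_iff.1 hs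
  have hR : 0 ≤ Metric.diam (closedTri K) / inballDiam K :=
    div_nonneg Metric.diam_nonneg inballDiam_pos.le
  have := hs.norm_le (h K) (by positivity)
  rwa [norm_gradₗ] at this

variable {Ω : Set Plane}

theorem localInverse_eq (hK : openTri K ⊆ Ω) {q : L2 Ω} {u : Fin 2 → L2 (openTri K)}
    {p : L2 (openTri K)} (h : SolvesLocal K (n + 1) (restrictL2 hK q) u p) :
    localInverse K hK (n + 1) q = fun i => zeroExtend Ω (isOpen_openTri K) (u i) := by
  have h' : ∃ u p, SolvesLocal K (n + 1) (restrictL2 hK q) u p := ⟨u, p, h⟩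
  rw [localInverse, dif_pos h']
  obtain ⟨p', hp'⟩ := h'.choose_spec
  rw [(hp'.unique h).1]

theorem isLinearMap_localInverse (hK : openTri K ⊆ Ω) :
    IsLinearMap ℝ (localInverse K hK (n + 1)) where
  map_add q q' := by
    obtain ⟨u, p, h⟩ := SolvesLocal.exists (n := n) (restrictL2 hK q)
    obtain ⟨u', p', h'⟩ := SolvesLocal.exists (n := n) (restrictL2 hK q')
    have hs := h.add h'
    rw [← restrictL2_add] at hs
    rw [localInverse_eq hK h, localInverse_eq hK h', localInverse_eq hK hs]
    funext i
    exact map_add (zeroExtendₗᵢ (isOpen_openTri K) hK) (u i) (u' i)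
  map_smul c q := by
    obtain ⟨u, p, h⟩ := SolvesLocal.exists (n := n) (restrictL2 hK q)
    have hs := h.smul c
    rw [← restrictL2_smul] at hs
    rw [localInverse_eq hK h, localInverse_eq hK hs]
    funext i
    exact map_smul (zeroExtendₗᵢ (isOpen_openTri K) hK) c (u i)

theorem gradNorm_zeroExtend (hΩ : IsOpen Ω) (hK : openTri K ⊆ Ω) {u : Fin 2 → L2 (openTri K)}
    (hu : ∀ i, u i ∈ H10 (openTri K)) :
    gradNorm Ω (fun i => zeroExtend Ω (isOpen_openTri K) (u i)) = gradNorm (openTri K) u := by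
  simp only [gradNorm, weakPartial_zeroExtend hΩ (isOpen_openTri K) hK (hu _)]
  simp only [← coe_zeroExtendₗᵢ (isOpen_openTri K) hK, LinearIsometry.norm_map]

theorem restrictL2_divergence_zeroExtend (hΩ : IsOpen Ω) (hK : openTri K ⊆ Ω)
    {u : Fin 2 → L2 (openTri K)} (hu : ∀ i, u i ∈ H10 (openTri K)) :
    restrictL2 hK (divergence Ω (fun i => zeroExtend Ω (isOpen_openTri K) (u i))) =
      divergence (openTri K) u := by
  simp only [divergence, weakPartial_zeroExtend hΩ (isOpen_openTri K) hK (hu _)]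
  simp only [← coe_zeroExtendₗᵢ (isOpen_openTri K) hK, ← map_sum]
  exact restrictL2_zeroExtend (isOpen_openTri K) hK _

end Local

end LocalStokes

end

theorem mainTheorem4 (ℓ : ℕ) (hℓ : 1 ≤ ℓ) :
    ∃ c : ℝ → ℝ, Monotone c ∧ (∀ s, 0 ≤ c s) ∧
      ∀ (Ω : Set LocalStokes.Plane) (_ : IsOpen Ω) (M : Finset LocalStokes.Triangle)
        (hM : LocalStokes.IsMesh Ω M) (K : LocalStokes.Triangle) (hK : K ∈ M),
        -- well-posedness of the local problem
        (∀ q : LocalStokes.L2 Ω,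
          ∃! up : (Fin 2 → LocalStokes.L2 (LocalStokes.openTri K)) ×
              LocalStokes.L2 (LocalStokes.openTri K),
            LocalStokes.SolvesLocal K ℓ
              (LocalStokes.restrictL2 (hM.subset K hK) q) up.1 up.2) ∧
        -- the operator is linear, with values in `H¹₀(Ω)²`
        IsLinearMap ℝ (LocalStokes.localInverse K (hM.subset K hK) ℓ) ∧
        (∀ q : LocalStokes.L2 Ω, ∀ i,
          LocalStokes.localInverse K (hM.subset K hK) ℓ q i ∈ LocalStokes.H10 Ω) ∧
        -- stability
        (∀ q : LocalStokes.L2 Ω,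
          LocalStokes.gradNorm Ω (LocalStokes.localInverse K (hM.subset K hK) ℓ q) ≤
            c (LocalStokes.shapeParameter M) *
              ‖LocalStokes.restrictL2 (hM.subset K hK) q‖) ∧
        -- right inverse property
        (∀ q : LocalStokes.L2 Ω,
          LocalStokes.restrictL2 (hM.subset K hK) q ∈ LocalStokes.polyAvg K (ℓ - 1) →
          LocalStokes.restrictL2 (hM.subset K hK)
              (LocalStokes.divergence Ω
                (LocalStokes.localInverse K (hM.subset K hK) ℓ q)) =
            LocalStokes.restrictL2 (hM.subset K hK) q) := by
  obtain ⟨n, rfl⟩ : ∃ n, ℓ = n + 1 := ⟨ℓ - 1, by omega⟩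
  obtain ⟨C, hC, hstab⟩ := LocalStokes.exists_gradNorm_le_of_solvesLocal n
  refine ⟨fun s => C * max s 0, fun s t hst => ?_, fun s => by positivity, ?_⟩
  · exact mul_le_mul_of_nonneg_left (max_le_max_right 0 hst) hC
  intro Ω hΩ M hM K hK
  have hKΩ := hM.subset K hK
  refine ⟨fun q => ?_, LocalStokes.isLinearMap_localInverse hKΩ, fun q i => ?_, fun q => ?_,
    fun q hq => ?_⟩
  all_goals
    obtain ⟨u, p, h⟩ :=
      LocalStokes.SolvesLocal.exists (n := n) (LocalStokes.restrictL2 hKΩ q)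
  · exact ⟨(u, p), h, fun y hy => Prod.ext (hy.unique h).1 (hy.unique h).2⟩
  · rw [LocalStokes.localInverse_eq hKΩ h]
    exact LocalStokes.zeroExtend_mem_H10 hΩ (LocalStokes.isOpen_openTri K) hKΩ (h.mem_H10 i)
  · rw [LocalStokes.localInverse_eq hKΩ h, LocalStokes.gradNorm_zeroExtend hΩ hKΩ h.mem_H10]
    refine (hstab K _ p u h).trans ?_
    exact mul_le_mul_of_nonneg_right (mul_le_mul_of_nonneg_left
      ((LocalStokes.div_le_shapeParameter hK).trans (le_max_left _ _)) hC) (norm_nonneg _)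
  · rw [LocalStokes.localInverse_eq hKΩ h,
      LocalStokes.restrictL2_divergence_zeroExtend hΩ hKΩ h.mem_H10]
    exact h.divergence_eq hq
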